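/- Let $(M,F)$ be a conic pseudo-Finsler surface: $M$ is a smooth surface, $\mathcal A\subset TM\setminus 0$ is a non-empty open set, invariant under $y\mapsto\lambda y$ for $\lambda>0$, that projects onto $M$, and $F:\mathcal A\to\mathbb R$ is smooth and positively homogeneous of degree $1$ in $y$, with non-degenerate metric tensor $g_{ij}=\tfrac12\dot\partial_i\dot\partial_jF^2$, where $\dot\partial_i=\partial/\partial y^i$. Let $\phi:\mathcal A\to\mathbb R$ be smooth and positively homogeneous of degree $0$ in $y$. Work in the coordinates $(x^i,y^i)$ induced on $TM$ by a chart of $M$. Put $\ell_i=\dot\partial_iF$, $\ell^i=y^i/F$, let $\varepsilon=\pm1$ be the sign of $\det(g_{ij})$, and let $(\ell^i,m^i)$ be a modified Berwald frame, i.e. $m_i$ is smooth with $g_{ij}-\ell_i\ell_j=\varepsilon m_im_j$, and $m^i=g^{ij}m_j$. The main scalar $\mathcal I$ is defined by $F\cdot\tfrac12\dot\partial_kg_{ij}=\mathcal I\,m_im_jm_k$. Let $G^i=\tfrac14g^{ij}(y^k\partial_k\dot\partial_jF^2-\partial_jF^2)$ be the geodesic spray coefficients of $F$, $G^i_j=\dot\partial_jG^i$,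 $\delta_i=\partial_i-G^j_i\dot\partial_j$, and let $B^i_{jkr}=\dot\partial_r\dot\partial_k\dot\partial_jG^i$ be the Berwald curvature of $F$. For a smooth function $f$ put $$f_{;2}=\varepsilon F(\dot\partial_if)m^i,\qquad f_{,1}=(\delta_if)\ell^i,\qquad f_{,2}=\varepsilon(\delta_if)m^i .$$ Let $\overline F=e^{\phi}F$ be an anisotropic conformal change of $F$, i.e. assume $$F^2\big(\dot\partial_i\dot\partial_j\phi+(\dot\partial_i\phi)(\dot\partial_j\phi)\big)m^im^j+\varepsilon\neq0,$$ and set $$\sigma=\phi_{;2;2}+\varepsilon\mathcal I\phi_{;2}+2(\phi_{;2})^2,\qquad \rho=\frac1{\sigma+\varepsilon-(\phi_{;2})^2},$$ $$2Q=\varepsilon\rho F^2(\phi_{;2}\phi_{,1}+\phi_{,1;2}-2\phi_{,2}),\qquad 2P=-\rho F^2\phi_{;2}(\phi_{;2}\phi_{,1}+\phi_{,1;2}-2\phi_{,2})+F^2\phi_{,1}.$$ Then the Berwald curvature $\overline B^i_{jkr}$ of $\overline F$, defined from $\overline F$ as $B^i_{jkr}$ is from $F$, satisfies on $\mathcal A$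 $$F^3\overline B^i_{jkr}=F^3B^i_{jkr}+[A\,\ell^i+B\,m^i]\,m_jm_km_r,$$ where $$A=(-3+\mathcal I_{;2})\varepsilon Q+(1+\mathcal I_{;2}+2\varepsilon\mathcal I^2)\varepsilon P_{;2}+P_{;2;2;2}-3Q_{;2;2}+3\varepsilon\mathcal IP_{;2;2}-3\varepsilon\mathcal IQ_{;2}+2\mathcal IP,$$ $$B=3P-(\mathcal I+\varepsilon\mathcal I_{;2;2}+\mathcal I\mathcal I_{;2})Q-(2\varepsilon\mathcal I_{;2}+\mathcal I^2-\varepsilon)Q_{;2}+3\varepsilon P_{;2;2}+Q_{;2;2;2}+3\mathcal IP_{;2}.$$ -/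

import Mathlib

open scoped Manifold ContDiff

noncomputable section

namespace FinslerSurface

/-- The coordinate plane. -/
abbrev Plane := EuclideanSpace ℝ (Fin 2)

/-- Functions `f (x, y)` of the induced coordinates `(x, y)` of a tangent bundle. -/
abbrev CoordFn := Plane → Plane → ℝ

/-! ### Calculus in the induced coordinates of the tangent bundle of a chart -/

/-- The partial derivative `∂_i = ∂/∂x^i`. -/
def dx (i : Fin 2) (f : CoordFn) : CoordFn := fun x y =>
  fderiv ℝ (fun z => f z y) x (EuclideanSpace.single i 1)

/-- The partial derivative `∂̇_i = ∂/∂y^i`. -/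
def dy (i : Fin 2) (f : CoordFn) : CoordFn := fun x y =>
  fderiv ℝ (fun w => f x w) y (EuclideanSpace.single i 1)

/-- The Lagrangian `F²`. -/
def lagrangian (F : CoordFn) : CoordFn := fun x y => F x y ^ 2

/-- The metric tensor `g_{ij} = (1/2) ∂̇_i ∂̇_j F²`. -/
def metric (F : CoordFn) (x y : Plane) : Matrix (Fin 2) (Fin 2) ℝ :=
  Matrix.of fun i j => (1 / 2) * dy i (dy j (lagrangian F)) x y

/-- The signature `ε = ±1`, the sign of `det (g_{ij})`; it is locally constant
where the metric tensor is non-degenerate. -/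
def eps (F : CoordFn) : CoordFn := fun x y => Real.sign (metric F x y).det

/-- `ℓ_i = ∂̇_i F`. -/
def ellLow (F : CoordFn) (i : Fin 2) : CoordFn := dy i F

/-- `ℓ^i = y^i / F`. -/
def ellUp (F : CoordFn) (i : Fin 2) : CoordFn := fun x y => y i / F x y

/-- The angular metric `h_{ij} = g_{ij} - ℓ_i ℓ_j`. -/
def angular (F : CoordFn) (i j : Fin 2) : CoordFn := fun x y =>
  metric F x y i j - ellLow F i x y * ellLow F j x y

/-- `(ℓ, m)` is a modified Berwald frame over `U`: the `m_i` are the components of a smooth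
`1`-form with `h_{ij} = ε m_i m_j`. -/
structure IsBerwaldFrame (F : CoordFn) (U : Set (Plane × Plane)) (m : Fin 2 → CoordFn) : Prop where
  smooth : ∀ i, ContDiffOn ℝ ∞ (fun p : Plane × Plane => m i p.1 p.2) U
  angular_eq : ∀ x y, (x, y) ∈ U → ∀ i j,
    angular F i j x y = eps F x y * m i x y * m j x y

/-- `m^i = g^{ij} m_j`. -/
def up (F : CoordFn) (m : Fin 2 → CoordFn) (i : Fin 2) : CoordFn := fun x y =>
  ∑ j, (metric F x y)⁻¹ i j * m j x y

/-- The Cartan tensor `C_{ijk} = (1/2) ∂̇_k g_{ij}`. -/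
def cartan (F : CoordFn) (i j k : Fin 2) : CoordFn := fun x y =>
  (1 / 2) * dy k (fun x y => metric F x y i j) x y

/-- The main scalar `𝓘`, determined by `F C_{ijk} = 𝓘 m_i m_j m_k`: as `m^i m_i = ε` and
`ε ^ 3 = ε`, it is `ε F C_{ijk} m^i m^j m^k`. -/
def mainScalar (F : CoordFn) (m : Fin 2 → CoordFn) : CoordFn := fun x y =>
  eps F x y * F x y *
    ∑ i, ∑ j, ∑ k, cartan F i j k x y * up F m i x y * up F m j x y * up F m k x y

/-- The coefficients `G^i` of the geodesic spray `S = y^i ∂_i - 2 G^i ∂̇_i` of `F`,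
`G^i = (1/4) g^{ij} (y^k ∂_k ∂̇_j F² - ∂_j F²)`. -/
def spray (F : CoordFn) (i : Fin 2) : CoordFn := fun x y =>
  (1 / 4) * ∑ j, (metric F x y)⁻¹ i j *
    ((∑ k, y k * dx k (dy j (lagrangian F)) x y) - dx j (lagrangian F) x y)

/-- The Barthel connection `G^i_j = ∂̇_j G^i`. -/
def barthel (F : CoordFn) (i j : Fin 2) : CoordFn := dy j (spray F i)

/-- The Berwald connection `G^i_{jk} = ∂̇_j G^i_k`. -/
def berwaldConnection (F : CoordFn) (i j k : Fin 2) : CoordFn := dy j (barthel F i k)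

/-- The Berwald curvature `B^i_{jkr} = ∂̇_r G^i_{jk}`. -/
def berwaldCurvature (F : CoordFn) (i j k r : Fin 2) : CoordFn := dy r (berwaldConnection F i j k)

/-- The horizontal derivative `δ_i f = ∂_i f - G^j_i ∂̇_j f`. -/
def delta (F : CoordFn) (i : Fin 2) (f : CoordFn) : CoordFn := fun x y =>
  dx i f x y - ∑ j, barthel F j i x y * dy j f x y

/-- The v-scalar derivative `f_{;2} = ε F (∂̇_i f) m^i`. -/
def v2 (F : CoordFn) (m : Fin 2 → CoordFn) (f : CoordFn) : CoordFn := fun x y =>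
  eps F x y * F x y * ∑ i, dy i f x y * up F m i x y

/-- The h-scalar derivative `f_{,1} = (δ_i f) ℓ^i`. -/
def h1 (F : CoordFn) (f : CoordFn) : CoordFn := fun x y =>
  ∑ i, delta F i f x y * ellUp F i x y

/-- The h-scalar derivative `f_{,2} = ε (δ_i f) m^i`. -/
def h2 (F : CoordFn) (m : Fin 2 → CoordFn) (f : CoordFn) : CoordFn := fun x y =>
  eps F x y * ∑ i, delta F i f x y * up F m i x y

/-! ### Anisotropic conformal changes -/

/-- The condition `F² (∂̇_i ∂̇_j φ + (∂̇_i φ) (∂̇_j φ)) m^i m^j + ε ≠ 0` over `U`. -/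
def Admissible (F : CoordFn) (m : Fin 2 → CoordFn) (φ : CoordFn) (U : Set (Plane × Plane)) : Prop :=
  ∀ x y, (x, y) ∈ U →
    F x y ^ 2 * (∑ i, ∑ j, (dy i (dy j φ) x y + dy i φ x y * dy j φ x y) *
      up F m i x y * up F m j x y) + eps F x y ≠ 0

/-- `σ = φ_{;2;2} + ε 𝓘 φ_{;2} + 2 (φ_{;2})²`. -/
def sigma (F : CoordFn) (m : Fin 2 → CoordFn) (φ : CoordFn) : CoordFn := fun x y =>
  v2 F m (v2 F m φ) x y + eps F x y * mainScalar F m x y * v2 F m φ x y + 2 * v2 F m φ x y ^ 2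

/-- `ρ = 1 / (σ + ε - (φ_{;2})²)`. -/
def rho (F : CoordFn) (m : Fin 2 → CoordFn) (φ : CoordFn) : CoordFn := fun x y =>
  1 / (sigma F m φ x y + eps F x y - v2 F m φ x y ^ 2)

/-- The function `Q`, with `2 Q = ε ρ F² (φ_{;2} φ_{,1} + φ_{,1;2} - 2 φ_{,2})`. -/
def sprayQ (F : CoordFn) (m : Fin 2 → CoordFn) (φ : CoordFn) : CoordFn := fun x y =>
  (1 / 2) * (eps F x y * rho F m φ x y * F x y ^ 2 *
    (v2 F m φ x y * h1 F φ x y + v2 F m (h1 F φ) x y - 2 * h2 F m φ x y))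

/-- The function `P`, with `2 P = -ρ F² φ_{;2} (φ_{;2} φ_{,1} + φ_{,1;2} - 2 φ_{,2}) + F² φ_{,1}`. -/
def sprayP (F : CoordFn) (m : Fin 2 → CoordFn) (φ : CoordFn) : CoordFn := fun x y =>
  (1 / 2) * (-(rho F m φ x y * F x y ^ 2 * v2 F m φ x y *
    (v2 F m φ x y * h1 F φ x y + v2 F m (h1 F φ) x y - 2 * h2 F m φ x y))
    + F x y ^ 2 * h1 F φ x y)

/-! ### Conic pseudo-Finsler surfaces -/

section Surface

variable {M : Type*} [TopologicalSpace M] [ChartedSpace Plane M] [IsManifold (𝓡 2) ∞ M]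

/-- A conic sub-bundle of the slit tangent bundle. -/
structure IsConicSubbundle (A : Set (TangentBundle (𝓡 2) M)) : Prop where
  nonempty : A.Nonempty
  isOpen : IsOpen A
  ne_zero : ∀ u ∈ A, u.2 ≠ 0
  smul_mem : ∀ u ∈ A, ∀ c : ℝ, 0 < c → (⟨u.1, c • u.2⟩ : TangentBundle (𝓡 2) M) ∈ A
  proj_surj : ∀ p : M, ∃ u ∈ A, u.1 = p

/-- `f` is positively homogeneous of degree `n` on `A`. -/
def IsHomogeneous (A : Set (TangentBundle (𝓡 2) M)) (n : ℕ) (f : TangentBundle (𝓡 2) M → ℝ) :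
    Prop :=
  ∀ u ∈ A, ∀ c : ℝ, 0 < c → f ⟨u.1, c • u.2⟩ = c ^ n * f u

/-- The point of the tangent bundle with coordinates `(x, y)` in the chart `e`: the tangent vector
`y^i ∂/∂x^i` at the point with coordinates `x`. -/
def tangentPoint (e : OpenPartialHomeomorph M Plane) (x y : Plane) : TangentBundle (𝓡 2) M :=
  ⟨e.symm x, mfderiv (𝓡 2) (𝓡 2) e.symm x y⟩

/-- The set of the coordinates `(x, y)` of those points of `A` that lie over the chart `e`. -/
def coordDomain (e : OpenPartialHomeomorph M Plane) (A : Set (TangentBundle (𝓡 2) M)) :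
    Set (Plane × Plane) :=
  {p | p.1 ∈ e.target ∧ tangentPoint e p.1 p.2 ∈ A}

/-- The expression of a function on the tangent bundle in the coordinates of the chart `e`. -/
def inChart (e : OpenPartialHomeomorph M Plane) (f : TangentBundle (𝓡 2) M → ℝ) : CoordFn :=
  fun x y => f (tangentPoint e x y)

/-- A conic pseudo-Finsler metric on the surface `M`, defined on the conic sub-bundle `A`. The
values of `F` outside `A` play no role. -/
structure IsConicPseudoFinsler (A : Set (TangentBundle (𝓡 2) M))
    (F : TangentBundle (𝓡 2) M → ℝ) : Prop where
  conic : IsConicSubbundle A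
  smooth : ContMDiffOn (𝓡 2).tangent 𝓘(ℝ, ℝ) ∞ F A
  homogeneous : IsHomogeneous A 1 F
  nondegenerate : ∀ e ∈ IsManifold.maximalAtlas (𝓡 2) ∞ M, ∀ x y, (x, y) ∈ coordDomain e A →
    (metric (inChart e F) x y).det ≠ 0

end Surface

end FinslerSurface

end

open FinslerSurface

/-!
Fix a chart and work in the induced coordinates, near a point, so that the signature `ε` is
constant. All objects are smooth and homogeneous in `y`; homogeneity enters only through Euler's
relation, which is recorded together with smoothness in `HomogeneousOn`.

The dual frames `(ℓ^i, m^i)` and `(ℓ_i, m_i)` turn vertical derivatives into scalar ones: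
`F ∂̇_j f = n f ℓ_j + f_{;2} m_j` for `f` of degree `n` (`IsFramedOn.mul_dy`). The Cartan tensor is
symmetric and vanishes on `y`, so it is `(𝓘 / F) m ⊗ m ⊗ m` (`IsFramedOn.mul_cartan`), and this
gives the vertical derivatives of the frame itself:
`F ∂̇_k ℓ^i = ε m^i m_k` and `F ∂̇_k m^i = -(ℓ^i + ε 𝓘 m^i) m_k`.

The spray coefficients are characterised by the Euler–Lagrange equations
`4 g_{ij} G^i = y^k ∂_k ∂̇_j F² - ∂_j F²`. For any function `f` the right-hand expression is
`∂̇_j (S f) - 2 δ_j f + 2 G^k ∂̇_k ∂̇_j f` (`IsFramedOn.eulerLagrange_eq`), where `S` is the spray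
of `F`. Applied to `F²` this yields `δ_j F = 0`; applied to `e^{2φ} F²` it determines the difference
of the two sprays from a linear system with the matrix
`ḡ_{ij} = e^{2φ} ((ℓ_i + φ_{;2} m_i) (ℓ_j + φ_{;2} m_j) + ρ⁻¹ m_i m_j)`,
whose solution is `Ḡ^i - G^i = P ℓ^i + Q m^i` (`IsFramedOn.spray_conformal`). It is regular as `ρ⁻¹`
is the left-hand side of the admissibility condition (`IsFramedOn.admissible_eq`).

It remains to differentiate `P ℓ^i + Q m^i` three times vertically. The field has degree `2`, so the
third derivative vanishes on `y` and is a multiple of `m_j m_k m_r`; the frame formulas give the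
factor (`IsFramedOn.cube_mul_dy_dy_dy_frameVector`).
-/

noncomputable section

namespace FinslerSurface

/-! ### Smooth functions of the induced coordinates and derivations -/

section Calculus

/-- `f` is smooth on `U`, as a function of the pair `(x, y)`. -/
def SmoothOn (U : Set (Plane × Plane)) (f : CoordFn) : Prop :=
  ContDiffOn ℝ ∞ (fun p : Plane × Plane => f p.1 p.2) U

variable {U : Set (Plane × Plane)} {f g : CoordFn} {x y : Plane}

theorem SmoothOn.contDiffAt (hU : IsOpen U) (hf : SmoothOn U f) (h : (x, y) ∈ U) :
    ContDiffAt ℝ ∞ (fun p : Plane × Plane => f p.1 p.2) (x, y) :=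
  ContDiffOn.contDiffAt hf (hU.mem_nhds h)

theorem SmoothOn.hasFDerivAt (hU : IsOpen U) (hf : SmoothOn U f) (h : (x, y) ∈ U) :
    HasFDerivAt (fun p : Plane × Plane => f p.1 p.2)
      (fderiv ℝ (fun p : Plane × Plane => f p.1 p.2) (x, y)) (x, y) :=
  ((hf.contDiffAt hU h).differentiableAt (by simp)).hasFDerivAt

theorem SmoothOn.hasFDerivAt_snd (hU : IsOpen U) (hf : SmoothOn U f) (h : (x, y) ∈ U) :
    HasFDerivAt (fun w => f x w)
      ((fderiv ℝ (fun p : Plane × Plane => f p.1 p.2) (x, y)).comp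
        (ContinuousLinearMap.inr ℝ Plane Plane)) y :=
  HasFDerivAt.comp (f := fun w : Plane => (x, w)) y (hf.hasFDerivAt hU h)
    (hasFDerivAt_prodMk_right x y)

theorem SmoothOn.hasFDerivAt_fst (hU : IsOpen U) (hf : SmoothOn U f) (h : (x, y) ∈ U) :
    HasFDerivAt (fun z => f z y)
      ((fderiv ℝ (fun p : Plane × Plane => f p.1 p.2) (x, y)).comp
        (ContinuousLinearMap.inl ℝ Plane Plane)) x :=
  HasFDerivAt.comp (f := fun z : Plane => (z, y)) x (hf.hasFDerivAt hU h)
    (hasFDerivAt_prodMk_left x y)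

theorem SmoothOn.dy_eq (hU : IsOpen U) (hf : SmoothOn U f) (h : (x, y) ∈ U) (i : Fin 2) :
    dy i f x y = fderiv ℝ (fun p : Plane × Plane => f p.1 p.2) (x, y)
      (0, EuclideanSpace.single i 1) := by
  rw [dy, (hf.hasFDerivAt_snd hU h).fderiv]; simp

theorem SmoothOn.dx_eq (hU : IsOpen U) (hf : SmoothOn U f) (h : (x, y) ∈ U) (i : Fin 2) :
    dx i f x y = fderiv ℝ (fun p : Plane × Plane => f p.1 p.2) (x, y)
      (EuclideanSpace.single i 1, 0) := by
  rw [dx, (hf.hasFDerivAt_fst hU h).fderiv]; simp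

theorem SmoothOn.congr (hf : SmoothOn U f) (h : ∀ x y, (x, y) ∈ U → g x y = f x y) :
    SmoothOn U g :=
  ContDiffOn.congr hf fun p hp => h p.1 p.2 hp

theorem SmoothOn.fderiv_apply (hU : IsOpen U) (hf : SmoothOn U f) (v : Plane × Plane) :
    SmoothOn U fun x y => fderiv ℝ (fun p : Plane × Plane => f p.1 p.2) (x, y) v :=
  (ContDiffOn.fderiv_of_isOpen hf hU (m := ∞) (by simp)).clm_apply contDiffOn_const

theorem SmoothOn.dy (hU : IsOpen U) (hf : SmoothOn U f) (i : Fin 2) : SmoothOn U (dy i f) :=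
  (hf.fderiv_apply hU _).congr fun _ _ h => hf.dy_eq hU h i

theorem SmoothOn.dx (hU : IsOpen U) (hf : SmoothOn U f) (i : Fin 2) : SmoothOn U (dx i f) :=
  (hf.fderiv_apply hU _).congr fun _ _ h => hf.dx_eq hU h i

theorem smoothOn_const (c : ℝ) : SmoothOn U fun _ _ => c := contDiffOn_const

theorem SmoothOn.add (hf : SmoothOn U f) (hg : SmoothOn U g) :
    SmoothOn U fun x y => f x y + g x y := ContDiffOn.add hf hg

theorem SmoothOn.sub (hf : SmoothOn U f) (hg : SmoothOn U g) :
    SmoothOn U fun x y => f x y - g x y := ContDiffOn.sub hf hg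

theorem SmoothOn.mul (hf : SmoothOn U f) (hg : SmoothOn U g) :
    SmoothOn U fun x y => f x y * g x y := ContDiffOn.mul hf hg

theorem SmoothOn.inv (hf : SmoothOn U f) (h : ∀ x y, (x, y) ∈ U → f x y ≠ 0) :
    SmoothOn U fun x y => (f x y)⁻¹ := ContDiffOn.inv hf fun p hp => h p.1 p.2 hp

theorem SmoothOn.exp (hf : SmoothOn U f) : SmoothOn U fun x y => Real.exp (f x y) :=
  ContDiffOn.exp hf

theorem smoothOn_coord (i : Fin 2) : SmoothOn U fun _ y => y i := by
  unfold SmoothOn; fun_prop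

/-- A first-order differential operator without zeroth-order term, acting on the functions that
are smooth on `U`: a local derivation, together with the chain rule for the exponential. -/
structure IsDerivationOn (U : Set (Plane × Plane)) (T : CoordFn → CoordFn) : Prop where
  congr : ∀ {f g : CoordFn}, (∀ x y, (x, y) ∈ U → f x y = g x y) →
    ∀ {x y}, (x, y) ∈ U → T f x y = T g x y
  const : ∀ (c : ℝ) {x y}, (x, y) ∈ U → T (fun _ _ => c) x y = 0
  add : ∀ {f g : CoordFn}, SmoothOn U f → SmoothOn U g → ∀ {x y}, (x, y) ∈ U →
    T (fun x y => f x y + g x y) x y = T f x y + T g x y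
  mul : ∀ {f g : CoordFn}, SmoothOn U f → SmoothOn U g → ∀ {x y}, (x, y) ∈ U →
    T (fun x y => f x y * g x y) x y = T f x y * g x y + f x y * T g x y
  exp : ∀ {f : CoordFn}, SmoothOn U f → ∀ {x y}, (x, y) ∈ U →
    T (fun x y => Real.exp (f x y)) x y = Real.exp (f x y) * T f x y

theorem isDerivationOn_dy (hU : IsOpen U) (i : Fin 2) : IsDerivationOn U (dy i) where
  congr {f g} hfg {x y} h := by
    have : (fun w => f x w) =ᶠ[nhds y] fun w => g x w := by
      have hc : Continuous fun w : Plane => (x, w) := by fun_prop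
      filter_upwards [(hU.preimage hc).mem_nhds h] with w hw using hfg x w hw
    unfold FinslerSurface.dy
    rw [this.fderiv_eq]
  const c {x y} h := by simp [FinslerSurface.dy]
  add {f g} hf hg {x y} h := by
    have := (hf.hasFDerivAt_snd hU h).add (hg.hasFDerivAt_snd hU h)
    rw [hf.dy_eq hU h, hg.dy_eq hU h]
    unfold FinslerSurface.dy
    erw [this.fderiv]
    simp
  mul {f g} hf hg {x y} h := by
    have := (hf.hasFDerivAt_snd hU h).mul (hg.hasFDerivAt_snd hU h)
    rw [hf.dy_eq hU h, hg.dy_eq hU h]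
    unfold FinslerSurface.dy
    erw [this.fderiv]
    simp
    ring
  exp {f} hf {x y} h := by
    have := (hf.hasFDerivAt_snd hU h).exp
    rw [hf.dy_eq hU h]
    unfold FinslerSurface.dy
    rw [this.fderiv]
    simp

theorem isDerivationOn_dx (hU : IsOpen U) (i : Fin 2) : IsDerivationOn U (dx i) where
  congr {f g} hfg {x y} h := by
    have : (fun z => f z y) =ᶠ[nhds x] fun z => g z y := by
      have hc : Continuous fun z : Plane => (z, y) := by fun_prop
      filter_upwards [(hU.preimage hc).mem_nhds h] with w hw using hfg w y hw
    unfold FinslerSurface.dx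
    rw [this.fderiv_eq]
  const c {x y} h := by simp [FinslerSurface.dx]
  add {f g} hf hg {x y} h := by
    have := (hf.hasFDerivAt_fst hU h).add (hg.hasFDerivAt_fst hU h)
    rw [hf.dx_eq hU h, hg.dx_eq hU h]
    unfold FinslerSurface.dx
    erw [this.fderiv]
    simp
  mul {f g} hf hg {x y} h := by
    have := (hf.hasFDerivAt_fst hU h).mul (hg.hasFDerivAt_fst hU h)
    rw [hf.dx_eq hU h, hg.dx_eq hU h]
    unfold FinslerSurface.dx
    erw [this.fderiv]
    simp
    ring
  exp {f} hf {x y} h := by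
    have := (hf.hasFDerivAt_fst hU h).exp
    rw [hf.dx_eq hU h]
    unfold FinslerSurface.dx
    rw [this.fderiv]
    simp

namespace IsDerivationOn

variable {T T' : CoordFn → CoordFn}

theorem const_mul (hT : IsDerivationOn U T) (c : ℝ) (hf : SmoothOn U f) (h : (x, y) ∈ U) :
    T (fun x y => c * f x y) x y = c * T f x y := by
  rw [hT.mul (smoothOn_const c) hf h, hT.const c h]; ring

theorem sub (hT : IsDerivationOn U T) (hf : SmoothOn U f) (hg : SmoothOn U g) (h : (x, y) ∈ U) :
    T (fun x y => f x y - g x y) x y = T f x y - T g x y := by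
  rw [hT.congr (g := fun x y => f x y + (-1) * g x y) (fun x y _ => by ring) h,
    hT.add hf ((smoothOn_const _).mul hg) h, hT.const_mul _ hg h]
  ring

theorem sq (hT : IsDerivationOn U T) (hf : SmoothOn U f) (h : (x, y) ∈ U) :
    T (fun x y => f x y ^ 2) x y = 2 * f x y * T f x y := by
  rw [hT.congr (g := fun x y => f x y * f x y) (fun x y _ => by ring) h, hT.mul hf hf h]
  ring

/-- The derivation of a function `f` that is given through a product `a * f = b`. -/
theorem mul_apply_of_mul_eq (hT : IsDerivationOn U T) {a b : CoordFn} (ha : SmoothOn U a)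
    (hf : SmoothOn U f) (hab : ∀ x y, (x, y) ∈ U → a x y * f x y = b x y) (h : (x, y) ∈ U) :
    a x y * T f x y = T b x y - T a x y * f x y := by
  rw [← hT.congr hab h, hT.mul ha hf h]; ring

theorem inv (hT : IsDerivationOn U T) (hf : SmoothOn U f)
    (h0 : ∀ x y, (x, y) ∈ U → f x y ≠ 0) (h : (x, y) ∈ U) :
    T (fun x y => (f x y)⁻¹) x y = -T f x y / f x y ^ 2 := by
  have := hT.mul_apply_of_mul_eq (b := fun _ _ => 1) hf (hf.inv h0)
    (fun x y h => mul_inv_cancel₀ (h0 x y h)) h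
  rw [hT.const 1 h] at this
  have h0 := h0 x y h
  field_simp at this ⊢
  linarith

theorem smul (hT : IsDerivationOn U T) (a : CoordFn) :
    IsDerivationOn U fun f x y => a x y * T f x y where
  congr hfg _ _ h := by rw [hT.congr hfg h]
  const c _ _ h := by rw [hT.const c h, mul_zero]
  add hf hg _ _ h := by rw [hT.add hf hg h]; ring
  mul hf hg _ _ h := by rw [hT.mul hf hg h]; ring
  exp hf _ _ h := by rw [hT.exp hf h]; ring

theorem add_op (hT : IsDerivationOn U T) (hT' : IsDerivationOn U T') :
    IsDerivationOn U fun f x y => T f x y + T' f x y where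
  congr hfg _ _ h := by rw [hT.congr hfg h, hT'.congr hfg h]
  const c _ _ h := by rw [hT.const c h, hT'.const c h, add_zero]
  add hf hg _ _ h := by rw [hT.add hf hg h, hT'.add hf hg h]; ring
  mul hf hg _ _ h := by rw [hT.mul hf hg h, hT'.mul hf hg h]; ring
  exp hf _ _ h := by rw [hT.exp hf h, hT'.exp hf h]; ring

theorem of_eq (hT : IsDerivationOn U T) (h : ∀ f x y, T' f x y = T f x y) :
    IsDerivationOn U T' := by
  have : T' = T := by funext f x y; exact h f x y
  rwa [this]

end IsDerivationOn

theorem two_le_infty : (2 : WithTop ℕ∞) ≤ ∞ := by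
  have h : ((2 : ℕ∞) : WithTop ℕ∞) ≤ ((⊤ : ℕ∞) : WithTop ℕ∞) := WithTop.coe_le_coe.2 le_top
  exact h

theorem fderiv_fderiv_apply_comm (hU : IsOpen U) (hf : SmoothOn U f) (h : (x, y) ∈ U)
    (v w : Plane × Plane) :
    fderiv ℝ (fun q : Plane × Plane => fderiv ℝ (fun p : Plane × Plane => f p.1 p.2) q v) (x, y) w =
      fderiv ℝ (fun q : Plane × Plane => fderiv ℝ (fun p : Plane × Plane => f p.1 p.2) q w)
        (x, y) v := by
  have h1 := hf.contDiffAt hU h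
  have h2 : DifferentiableAt ℝ (fderiv ℝ (fun p : Plane × Plane => f p.1 p.2)) (x, y) :=
    (h1.fderiv_right (m := 1) two_le_infty).differentiableAt (by simp)
  have h3 : IsSymmSndFDerivAt ℝ (fun p : Plane × Plane => f p.1 p.2) (x, y) :=
    h1.isSymmSndFDerivAt (by simpa using two_le_infty)
  rw [fderiv_clm_apply h2 (differentiableAt_const v),
    fderiv_clm_apply h2 (differentiableAt_const w)]
  simpa using h3 w v

theorem dy_dy_comm (hU : IsOpen U) (hf : SmoothOn U f) (h : (x, y) ∈ U) (i j : Fin 2) :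
    dy i (dy j f) x y = dy j (dy i f) x y := by
  rw [(isDerivationOn_dy hU i).congr (fun _ _ h => hf.dy_eq hU h j) h,
    (isDerivationOn_dy hU j).congr (fun _ _ h => hf.dy_eq hU h i) h,
    (hf.fderiv_apply hU _).dy_eq hU h, (hf.fderiv_apply hU _).dy_eq hU h]
  exact fderiv_fderiv_apply_comm hU hf h _ _

theorem dx_dy_comm (hU : IsOpen U) (hf : SmoothOn U f) (h : (x, y) ∈ U) (i j : Fin 2) :
    dx i (dy j f) x y = dy j (dx i f) x y := by
  rw [(isDerivationOn_dx hU i).congr (fun _ _ h => hf.dy_eq hU h j) h,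
    (isDerivationOn_dy hU j).congr (fun _ _ h => hf.dx_eq hU h i) h,
    (hf.fderiv_apply hU _).dx_eq hU h, (hf.fderiv_apply hU _).dy_eq hU h]
  exact fderiv_fderiv_apply_comm hU hf h _ _

theorem dy_coord (i k : Fin 2) :
    dy i (fun _ y => y k) x y = if i = k then 1 else 0 := by
  unfold dy
  have : HasFDerivAt (fun w : Plane => w k) (EuclideanSpace.proj k : Plane →L[ℝ] ℝ) y :=
    (EuclideanSpace.proj k : Plane →L[ℝ] ℝ).hasFDerivAt
  rw [this.fderiv]
  simp [eq_comm]

theorem dx_coord (i k : Fin 2) : dx i (fun _ y => y k) x y = 0 := by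
  simp [dx]

end Calculus

/-! ### The tangent bundle in a chart -/

section Chart

variable {M : Type*} [TopologicalSpace M] [ChartedSpace Plane M]

theorem contMDiff_tangentBundle_mk :
    ContMDiff 𝓘(ℝ, Plane × Plane) (𝓡 2).tangent ∞
      (fun p : Plane × Plane => (⟨p.1, p.2⟩ : TangentBundle (𝓡 2) Plane)) := by
  have h := contMDiff_tangentBundleModelSpaceHomeomorph_symm (𝕜 := ℝ) (I := 𝓡 2) (n := ∞)
  have e1 : 𝓘(ℝ, Plane × Plane) = (𝓡 2).tangent := modelWithCornersSelf_prod
  rw [e1]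
  exact h

/-- The induced coordinates are smooth: `tangentPoint e` is the tangent map of the inverse chart. -/
theorem contMDiffOn_tangentPoint {e : OpenPartialHomeomorph M Plane} [IsManifold (𝓡 2) ∞ M]
    (he : e ∈ IsManifold.maximalAtlas (𝓡 2) ∞ M) :
    ContMDiffOn 𝓘(ℝ, Plane × Plane) (𝓡 2).tangent ∞
      (fun p : Plane × Plane => tangentPoint e p.1 p.2) (Prod.fst ⁻¹' e.target) := by
  have h1 := contMDiffOn_symm_of_mem_maximalAtlas he
  have : IsManifold (𝓡 2) 1 M := IsManifold.of_le (n := ∞) (by simp)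
  have h2 := h1.contMDiffOn_tangentMapWithin (m := ∞) (by simp) e.open_target.uniqueMDiffOn
  have h3 := h2.comp contMDiff_tangentBundle_mk.contMDiffOn (s := Prod.fst ⁻¹' e.target)
    (fun p hp => hp)
  refine h3.congr fun p hp => ?_
  have h4 : UniqueMDiffWithinAt (𝓡 2) e.target p.1 := e.open_target.uniqueMDiffOn p.1 hp
  have h5 : MDifferentiableAt (𝓡 2) (𝓡 2) e.symm p.1 :=
    ((h1 p.1 hp).contMDiffAt (e.open_target.mem_nhds hp)).mdifferentiableAt (by simp)
  simp only [Function.comp, tangentMapWithin, tangentPoint]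
  rw [mfderivWithin_eq_mfderiv h4 h5]

theorem isOpen_coordDomain {e : OpenPartialHomeomorph M Plane} [IsManifold (𝓡 2) ∞ M]
    (he : e ∈ IsManifold.maximalAtlas (𝓡 2) ∞ M) {A : Set (TangentBundle (𝓡 2) M)}
    (hA : IsOpen A) : IsOpen (coordDomain e A) :=
  (contMDiffOn_tangentPoint he).continuousOn.isOpen_inter_preimage
    (e.open_target.preimage continuous_fst) hA

theorem smoothOn_inChart {e : OpenPartialHomeomorph M Plane} [IsManifold (𝓡 2) ∞ M]
    (he : e ∈ IsManifold.maximalAtlas (𝓡 2) ∞ M) {A : Set (TangentBundle (𝓡 2) M)}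
    {f : TangentBundle (𝓡 2) M → ℝ} (hf : ContMDiffOn (𝓡 2).tangent 𝓘(ℝ, ℝ) ∞ f A) :
    SmoothOn (coordDomain e A) (inChart e f) := by
  have h := hf.comp ((contMDiffOn_tangentPoint he).mono (t := coordDomain e A) fun p hp => hp.1)
    fun p hp => hp.2
  exact contMDiffOn_iff_contDiffOn.1 h

theorem inChart_smul {e : OpenPartialHomeomorph M Plane} {A : Set (TangentBundle (𝓡 2) M)}
    {n : ℕ} {f : TangentBundle (𝓡 2) M → ℝ} (hf : IsHomogeneous A n f) {x y : Plane}
    (h : (x, y) ∈ coordDomain e A) {c : ℝ} (hc : 0 < c) :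
    inChart e f x (c • y) = c ^ n * inChart e f x y := by
  rw [inChart, inChart, ← hf _ h.2 c hc]
  exact congrArg (fun v => f ⟨e.symm x, v⟩) (map_smul (mfderiv (𝓡 2) (𝓡 2) e.symm x) c y)

/-- Euler's relation `y^i ∂̇_i f = n f`. -/
theorem euler_inChart {e : OpenPartialHomeomorph M Plane} [IsManifold (𝓡 2) ∞ M]
    (he : e ∈ IsManifold.maximalAtlas (𝓡 2) ∞ M) {A : Set (TangentBundle (𝓡 2) M)}
    (hA : IsOpen A)
    {f : TangentBundle (𝓡 2) M → ℝ} (hf : ContMDiffOn (𝓡 2).tangent 𝓘(ℝ, ℝ) ∞ f A)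
    {n : ℕ} (hn : IsHomogeneous A n f) {x y : Plane} (h : (x, y) ∈ coordDomain e A) :
    y 0 * dy 0 (inChart e f) x y + y 1 * dy 1 (inChart e f) x y = n * inChart e f x y := by
  have hs := smoothOn_inChart he hf
  have hU := isOpen_coordDomain he hA
  have h1 := hs.hasFDerivAt_snd hU h
  have h2 : HasDerivAt (fun c : ℝ => c • y) y 1 := by
    simpa using (hasDerivAt_id (1 : ℝ)).smul_const y
  have h3 : HasDerivAt (fun c : ℝ => inChart e f x (c • y))
      (((fderiv ℝ (fun p : Plane × Plane => inChart e f p.1 p.2) (x, y)).comp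
        (ContinuousLinearMap.inr ℝ Plane Plane)) y) 1 := by
    rw [← one_smul ℝ y] at h1
    have h3 := h1.comp_hasDerivAt (1 : ℝ) h2
    rwa [one_smul] at h3
  have h4 : HasDerivAt (fun c : ℝ => c ^ n * inChart e f x y) (n * inChart e f x y) 1 := by
    simpa using (hasDerivAt_pow n (1 : ℝ)).mul_const (inChart e f x y)
  have h5 : (fun c : ℝ => inChart e f x (c • y)) =ᶠ[nhds 1]
      fun c : ℝ => c ^ n * inChart e f x y := by
    filter_upwards [lt_mem_nhds (show (0 : ℝ) < 1 by norm_num)] with c hc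
    exact inChart_smul hn h hc
  rw [← h3.unique (h4.congr_of_eventuallyEq h5), hs.dy_eq hU h, hs.dy_eq hU h]
  have hy : y = y 0 • EuclideanSpace.single 0 1 + y 1 • EuclideanSpace.single 1 1 := by
    ext i; fin_cases i <;> simp
  have hy' : ContinuousLinearMap.inr ℝ Plane Plane y =
      y 0 • ((0 : Plane), EuclideanSpace.single (0 : Fin 2) (1 : ℝ)) +
        y 1 • ((0 : Plane), EuclideanSpace.single (1 : Fin 2) (1 : ℝ)) := by
    conv_lhs => rw [hy]
    simp
  rw [ContinuousLinearMap.comp_apply, hy', map_add, map_smul, map_smul, smul_eq_mul, smul_eq_mul]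

end Chart

/-! ### Homogeneous functions and the Berwald frame -/

theorem isDerivationOn_euler {U : Set (Plane × Plane)} (hU : IsOpen U) :
    IsDerivationOn U fun f x y => y 0 * dy 0 f x y + y 1 * dy 1 f x y :=
  ((isDerivationOn_dy hU 0).smul fun _ y => y 0).add_op
    ((isDerivationOn_dy hU 1).smul fun _ y => y 1)

/-- `f` is smooth on `U` and satisfies there Euler's relation of degree `n`; along connected
pieces of rays this says that `f` is positively homogeneous of degree `n` in `y`. -/
structure HomogeneousOn (U : Set (Plane × Plane)) (n : ℝ) (f : CoordFn) : Prop where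
  smooth : SmoothOn U f
  euler : ∀ x y, (x, y) ∈ U → y 0 * dy 0 f x y + y 1 * dy 1 f x y = n * f x y

namespace HomogeneousOn

variable {U : Set (Plane × Plane)} {f g : CoordFn} {x y : Plane} {n k : ℝ}

theorem congr_deg (hf : HomogeneousOn U n f) (h : n = k) : HomogeneousOn U k f := h ▸ hf

theorem congr (hU : IsOpen U) (hf : HomogeneousOn U n f)
    (h : ∀ x y, (x, y) ∈ U → g x y = f x y) : HomogeneousOn U n g where
  smooth := hf.smooth.congr h
  euler x y hp := by
    have := (isDerivationOn_euler hU).congr h hp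
    simp only at this
    rw [this, hf.euler x y hp, h x y hp]

theorem const (hU : IsOpen U) (c : ℝ) : HomogeneousOn U 0 fun _ _ => c where
  smooth := smoothOn_const c
  euler x y h := by simpa using (isDerivationOn_euler hU).const c h

theorem coord (i : Fin 2) : HomogeneousOn U 1 fun _ y => y i where
  smooth := smoothOn_coord i
  euler x y h := by
    rw [dy_coord, dy_coord]
    fin_cases i <;> simp

theorem add (hU : IsOpen U) (hf : HomogeneousOn U n f) (hg : HomogeneousOn U n g) :
    HomogeneousOn U n fun x y => f x y + g x y where
  smooth := hf.smooth.add hg.smooth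
  euler x y h := by
    have := (isDerivationOn_euler hU).add hf.smooth hg.smooth h
    simp only at this
    rw [this, hf.euler x y h, hg.euler x y h]; ring

theorem mul (hU : IsOpen U) (hf : HomogeneousOn U n f) (hg : HomogeneousOn U k g) :
    HomogeneousOn U (n + k) fun x y => f x y * g x y where
  smooth := hf.smooth.mul hg.smooth
  euler x y h := by
    have := (isDerivationOn_euler hU).mul hf.smooth hg.smooth h
    simp only at this
    rw [this, hf.euler x y h, hg.euler x y h]; ring

theorem const_mul (hU : IsOpen U) (c : ℝ) (hf : HomogeneousOn U n f) :
    HomogeneousOn U n fun x y => c * f x y :=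
  ((HomogeneousOn.const hU c).mul hU hf).congr_deg (zero_add n)

theorem sub (hU : IsOpen U) (hf : HomogeneousOn U n f) (hg : HomogeneousOn U n g) :
    HomogeneousOn U n fun x y => f x y - g x y :=
  (hf.add hU (hg.const_mul hU (-1))).congr hU fun x y _ => by ring

theorem inv (hU : IsOpen U) (hf : HomogeneousOn U n f) (h0 : ∀ x y, (x, y) ∈ U → f x y ≠ 0) :
    HomogeneousOn U (-n) fun x y => (f x y)⁻¹ where
  smooth := hf.smooth.inv h0
  euler x y h := by
    have := (isDerivationOn_euler hU).inv hf.smooth h0 h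
    simp only at this
    rw [this, hf.euler x y h]
    have := h0 x y h
    field_simp

theorem exp (hU : IsOpen U) (hf : HomogeneousOn U 0 f) :
    HomogeneousOn U 0 fun x y => Real.exp (f x y) where
  smooth := hf.smooth.exp
  euler x y h := by
    have := (isDerivationOn_euler hU).exp hf.smooth h
    simp only at this
    rw [this, hf.euler x y h]; ring

theorem dy (hU : IsOpen U) (hf : HomogeneousOn U n f) (i : Fin 2) :
    HomogeneousOn U (n - 1) (dy i f) where
  smooth := hf.smooth.dy hU i
  euler x y h := by
    have hs (j) := hf.smooth.dy hU j
    have hD := isDerivationOn_dy hU i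
    have h1 := hD.congr hf.euler h
    rw [hD.add ((smoothOn_coord 0).mul (hs 0)) ((smoothOn_coord 1).mul (hs 1)) h,
      hD.mul (smoothOn_coord 0) (hs 0) h, hD.mul (smoothOn_coord 1) (hs 1) h,
      hD.const_mul n hf.smooth h, dy_coord, dy_coord, dy_dy_comm hU hf.smooth h i 0,
      dy_dy_comm hU hf.smooth h i 1] at h1
    fin_cases i <;> simp at h1 ⊢ <;> linarith

theorem dx (hU : IsOpen U) (hf : HomogeneousOn U n f) (i : Fin 2) :
    HomogeneousOn U n (dx i f) where
  smooth := hf.smooth.dx hU i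
  euler x y h := by
    have hs (j) := hf.smooth.dy hU j
    have hD := isDerivationOn_dx hU i
    have h1 := hD.congr hf.euler h
    rw [hD.add ((smoothOn_coord 0).mul (hs 0)) ((smoothOn_coord 1).mul (hs 1)) h,
      hD.mul (smoothOn_coord 0) (hs 0) h, hD.mul (smoothOn_coord 1) (hs 1) h,
      hD.const_mul n hf.smooth h, dx_coord, dx_coord, dx_dy_comm hU hf.smooth h i 0,
      dx_dy_comm hU hf.smooth h i 1] at h1
    linarith

end HomogeneousOn

/-- A domain `U` of the induced coordinates on which `F` is a pseudo-Finsler metric whose metric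
tensor has constant signature `e = ±1`, with the covector field `m` of a modified Berwald frame. -/
structure IsFramedOn (U : Set (Plane × Plane)) (F : CoordFn) (m : Fin 2 → CoordFn) (e : ℝ) :
    Prop where
  isOpen : IsOpen U
  homogeneous : HomogeneousOn U 1 F
  det_ne_zero : ∀ x y, (x, y) ∈ U → (metric F x y).det ≠ 0
  eps_eq : ∀ x y, (x, y) ∈ U → eps F x y = e
  sq_eq_one : e * e = 1
  smooth : ∀ i, SmoothOn U (m i)
  angular_eq : ∀ x y, (x, y) ∈ U → ∀ i j, angular F i j x y = e * m i x y * m j x y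

theorem HomogeneousOn.lagrangian {U : Set (Plane × Plane)} {F : CoordFn} (hU : IsOpen U)
    (hF : HomogeneousOn U 1 F) : HomogeneousOn U 2 (lagrangian F) :=
  ((hF.mul hU hF).congr hU fun x y _ => by rw [FinslerSurface.lagrangian]; ring).congr_deg
    (by norm_num)

theorem dy_lagrangian {U : Set (Plane × Plane)} {F : CoordFn} {x y : Plane} (hU : IsOpen U)
    (hF : SmoothOn U F) (h : (x, y) ∈ U) (j : Fin 2) :
    dy j (lagrangian F) x y = 2 * (F x y * dy j F x y) := by
  unfold lagrangian
  rw [(isDerivationOn_dy hU j).sq hF h]; ring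

theorem metric_eq {U : Set (Plane × Plane)} {F : CoordFn} {x y : Plane} (hU : IsOpen U)
    (hF : SmoothOn U F) (h : (x, y) ∈ U) (i j : Fin 2) :
    metric F x y i j = F x y * dy i (dy j F) x y + dy i F x y * dy j F x y := by
  have hD := isDerivationOn_dy hU i
  rw [metric, Matrix.of_apply, hD.congr (fun x y h => dy_lagrangian hU hF h j) h,
    hD.const_mul 2 (hF.mul (hF.dy hU j)) h, hD.mul hF (hF.dy hU j) h]
  ring

theorem HomogeneousOn.metric {U : Set (Plane × Plane)} {F : CoordFn} (hU : IsOpen U)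
    (hF : HomogeneousOn U 1 F) (i j : Fin 2) :
    HomogeneousOn U 0 fun x y => metric F x y i j :=
  (((hF.lagrangian hU).dy hU j).dy hU i).const_mul hU (1 / 2) |>.congr_deg (by norm_num)

variable {U : Set (Plane × Plane)} {F φ : CoordFn} {m : Fin 2 → CoordFn} {e : ℝ} {x y : Plane}

namespace IsFramedOn

/-- Where `F = 0`, the metric tensor is `ℓ ⊗ ℓ`, hence degenerate. -/
theorem ne_zero (H : IsFramedOn U F m e) (h : (x, y) ∈ U) : F x y ≠ 0 := by
  intro h0
  apply H.det_ne_zero x y h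
  rw [Matrix.det_fin_two]
  simp only [metric_eq H.isOpen H.homogeneous.smooth h, h0]
  ring

theorem metric_eq (H : IsFramedOn U F m e) (h : (x, y) ∈ U) (i j : Fin 2) :
    metric F x y i j = dy i F x y * dy j F x y + e * m i x y * m j x y := by
  have := H.angular_eq x y h i j
  simp only [angular, ellLow] at this
  linarith

theorem mul_dy_dy (H : IsFramedOn U F m e) (h : (x, y) ∈ U) (i j : Fin 2) :
    F x y * dy i (dy j F) x y = e * m i x y * m j x y := by
  have := FinslerSurface.metric_eq H.isOpen H.homogeneous.smooth h i j
  rw [H.metric_eq h] at this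
  linarith

end IsFramedOn

/-- The area `ℓ ∧ m` of the coframe. -/
def area (F : CoordFn) (m : Fin 2 → CoordFn) : CoordFn := fun x y =>
  dy 0 F x y * m 1 x y - dy 1 F x y * m 0 x y

namespace IsFramedOn

theorem det_metric (H : IsFramedOn U F m e) (h : (x, y) ∈ U) :
    (metric F x y).det = e * area F m x y ^ 2 := by
  rw [Matrix.det_fin_two]
  simp only [H.metric_eq h, area]
  ring

theorem area_ne_zero (H : IsFramedOn U F m e) (h : (x, y) ∈ U) : area F m x y ≠ 0 := by
  intro h0
  apply H.det_ne_zero x y h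
  rw [H.det_metric h, h0]; ring

theorem e_ne_zero (H : IsFramedOn U F m e) : e ≠ 0 := by
  intro h; have := H.sq_eq_one; simp [h] at this

end IsFramedOn

theorem inv_metric :
    (metric F x y)⁻¹ = (metric F x y).det⁻¹ •
      !![metric F x y 1 1, -metric F x y 0 1; -metric F x y 1 0, metric F x y 0 0] := by
  rw [Matrix.inv_def, Matrix.adjugate_fin_two, Ring.inverse_eq_inv]

namespace IsFramedOn

theorem up_zero (H : IsFramedOn U F m e) (h : (x, y) ∈ U) :
    up F m 0 x y = -(e * dy 1 F x y * (area F m x y)⁻¹) := by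
  have h0 := H.area_ne_zero h
  have h1 := H.e_ne_zero
  have h2 := H.sq_eq_one
  rw [up, Fin.sum_univ_two, inv_metric]
  simp only [Matrix.smul_apply, Matrix.of_apply, Matrix.cons_val', Matrix.cons_val_zero,
    Matrix.cons_val_one, Matrix.cons_val_fin_one, smul_eq_mul, H.det_metric h, H.metric_eq h]
  field_simp
  unfold area
  linear_combination (dy 0 F x y * m 1 x y - dy 1 F x y * m 0 x y) * dy 1 F x y * h2

theorem up_one (H : IsFramedOn U F m e) (h : (x, y) ∈ U) :
    up F m 1 x y = e * dy 0 F x y * (area F m x y)⁻¹ := by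
  have h0 := H.area_ne_zero h
  have h1 := H.e_ne_zero
  have h2 := H.sq_eq_one
  rw [up, Fin.sum_univ_two, inv_metric]
  simp only [Matrix.smul_apply, Matrix.of_apply, Matrix.cons_val', Matrix.cons_val_zero,
    Matrix.cons_val_one, Matrix.cons_val_fin_one, smul_eq_mul, H.det_metric h, H.metric_eq h]
  field_simp
  unfold area
  linear_combination -(dy 0 F x y * m 1 x y - dy 1 F x y * m 0 x y) * dy 0 F x y * h2

theorem euler (H : IsFramedOn U F m e) (h : (x, y) ∈ U) :
    y 0 * dy 0 F x y + y 1 * dy 1 F x y = F x y := by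
  rw [H.homogeneous.euler x y h, one_mul]

/-- The covector `m` vanishes on `y`, since `ℓ_j` has degree `0` and `F ∂̇_i ℓ_j = ε m_i m_j`. -/
theorem m_coord (H : IsFramedOn U F m e) (h : (x, y) ∈ U) :
    y 0 * m 0 x y + y 1 * m 1 x y = 0 := by
  have h0 := H.area_ne_zero h
  have key (j) : m j x y * (y 0 * m 0 x y + y 1 * m 1 x y) = 0 := by
    have h1 := (H.homogeneous.dy H.isOpen j).euler x y h
    linear_combination e * F x y * h1 - e * y 0 * H.mul_dy_dy h 0 j
      - e * y 1 * H.mul_dy_dy h 1 j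
      - (m j x y * (y 0 * m 0 x y + y 1 * m 1 x y)) * H.sq_eq_one
  by_contra h1
  have k0 := (mul_eq_zero.1 (key 0)).resolve_right h1
  have k1 := (mul_eq_zero.1 (key 1)).resolve_right h1
  apply h0
  rw [area, k0, k1]; ring

theorem ell_up (H : IsFramedOn U F m e) (h : (x, y) ∈ U) :
    dy 0 F x y * up F m 0 x y + dy 1 F x y * up F m 1 x y = 0 := by
  rw [H.up_zero h, H.up_one h]; ring

theorem m_up (H : IsFramedOn U F m e) (h : (x, y) ∈ U) :
    m 0 x y * up F m 0 x y + m 1 x y * up F m 1 x y = e := by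
  have h0 := H.area_ne_zero h
  rw [H.up_zero h, H.up_one h]
  field_simp
  rw [area]; ring

theorem ell_ellUp (H : IsFramedOn U F m e) (h : (x, y) ∈ U) :
    dy 0 F x y * ellUp F 0 x y + dy 1 F x y * ellUp F 1 x y = 1 := by
  have h0 := H.ne_zero h
  have := H.euler h
  simp only [ellUp]
  field_simp
  linarith

theorem m_ellUp (H : IsFramedOn U F m e) (h : (x, y) ∈ U) :
    m 0 x y * ellUp F 0 x y + m 1 x y * ellUp F 1 x y = 0 := by
  have h0 := H.ne_zero h
  have := H.m_coord h
  simp only [ellUp]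
  field_simp
  linarith

/-- A vector is determined by its contractions with the coframe `(ℓ_i, m_i)`. -/
theorem vector_ext (H : IsFramedOn U F m e) (h : (x, y) ∈ U) {v w : Fin 2 → ℝ}
    (hl : dy 0 F x y * v 0 + dy 1 F x y * v 1 = dy 0 F x y * w 0 + dy 1 F x y * w 1)
    (hm : m 0 x y * v 0 + m 1 x y * v 1 = m 0 x y * w 0 + m 1 x y * w 1) (i : Fin 2) :
    v i = w i := by
  have h0 := H.area_ne_zero h
  have h1 : area F m x y = dy 0 F x y * m 1 x y - dy 1 F x y * m 0 x y := rfl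
  fin_cases i
  · apply mul_left_cancel₀ h0
    simp only [h1, Fin.zero_eta]
    linear_combination m 1 x y * hl - dy 1 F x y * hm
  · apply mul_left_cancel₀ h0
    simp only [h1, Fin.mk_one]
    linear_combination -m 0 x y * hl + dy 0 F x y * hm

/-- A covector is determined by its contractions with the frame `(ℓ^i, m^i)`. -/
theorem covector_eq (H : IsFramedOn U F m e) (h : (x, y) ∈ U) (t : Fin 2 → ℝ) (i : Fin 2) :
    t i = (t 0 * ellUp F 0 x y + t 1 * ellUp F 1 x y) * dy i F x y
      + e * (t 0 * up F m 0 x y + t 1 * up F m 1 x y) * m i x y := by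
  have key (j : Fin 2) : ∀ k : Fin 2, (if k = j then (1 : ℝ) else 0) =
      ellUp F k x y * dy j F x y + e * up F m k x y * m j x y := by
    have h1 := H.ell_up h
    have h2 := H.m_up h
    have h3 := H.ell_ellUp h
    have h4 := H.m_ellUp h
    refine fun k => H.vector_ext h (v := fun k => if k = j then (1 : ℝ) else 0)
      (w := fun k => ellUp F k x y * dy j F x y + e * up F m k x y * m j x y) ?_ ?_ k
    · fin_cases j
      · simp
        linear_combination -dy 0 F x y * h3 - e * m 0 x y * h1
      · simp
        linear_combination -dy 1 F x y * h3 - e * m 1 x y * h1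
    · fin_cases j
      · simp
        linear_combination -dy 0 F x y * h4 - e * m 0 x y * h2 - m 0 x y * H.sq_eq_one
      · simp
        linear_combination -dy 1 F x y * h4 - e * m 1 x y * h2 - m 1 x y * H.sq_eq_one
  have k0 := key i 0
  have k1 := key i 1
  have : t i = t 0 * (if (0 : Fin 2) = i then 1 else 0)
      + t 1 * (if (1 : Fin 2) = i then 1 else 0) := by
    fin_cases i <;> simp
  rw [k0, k1] at this
  rw [this]; ring

theorem v2_eq (H : IsFramedOn U F m e) (h : (x, y) ∈ U) (f : CoordFn) :
    v2 F m f x y = e * F x y * (dy 0 f x y * up F m 0 x y + dy 1 f x y * up F m 1 x y) := by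
  rw [v2, H.eps_eq x y h, Fin.sum_univ_two]

/-- The vertical derivative in the frame: `F ∂̇_j f = n f ℓ_j + f_{;2} m_j` for `f` homogeneous of
degree `n`. -/
theorem mul_dy (H : IsFramedOn U F m e) {n : ℝ} {f : CoordFn} (hf : HomogeneousOn U n f)
    (h : (x, y) ∈ U) (j : Fin 2) :
    F x y * dy j f x y = n * f x y * dy j F x y + v2 F m f x y * m j x y := by
  have h0 := H.ne_zero h
  have h1 := H.covector_eq h (fun i => dy i f x y) j
  have h2 := hf.euler x y h
  have h3 : F x y * (dy 0 f x y * ellUp F 0 x y + dy 1 f x y * ellUp F 1 x y) = n * f x y := by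
    rw [← h2, ellUp, ellUp]; field_simp
  rw [H.v2_eq h, ← h3, h1]
  ring

theorem smooth_up (H : IsFramedOn U F m e) (i : Fin 2) : SmoothOn U (up F m i) := by
  have hl := fun i => H.homogeneous.smooth.dy H.isOpen i
  have ha : SmoothOn U fun x y => (area F m x y)⁻¹ :=
    (((hl 0).mul (H.smooth 1)).sub ((hl 1).mul (H.smooth 0))).inv fun x y h => H.area_ne_zero h
  fin_cases i
  · refine ((((smoothOn_const (-e)).mul (hl 1)).mul ha)).congr fun x y h => ?_
    simp only [Fin.zero_eta, H.up_zero h]; ring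
  · refine ((((smoothOn_const e).mul (hl 0)).mul ha)).congr fun x y h => ?_
    simp only [Fin.mk_one, H.up_one h]

end IsFramedOn

theorem isDerivationOn_v2 (hU : IsOpen U) : IsDerivationOn U (v2 F m) :=
  ((((isDerivationOn_dy hU 0).smul (up F m 0)).add_op
    ((isDerivationOn_dy hU 1).smul (up F m 1))).smul fun x y => eps F x y * F x y).of_eq
    fun f x y => by rw [v2, Fin.sum_univ_two]; ring

/-! ### Vertical derivatives of the frame -/

namespace IsFramedOn

/-- A function whose vertical derivative is a multiple of `m` has degree `0`, as `m` vanishes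
on `y`. -/
theorem homogeneous_of_mul_dy (H : IsFramedOn U F m e) {f : CoordFn} (hf : SmoothOn U f)
    (a : CoordFn)
    (h : ∀ x y, (x, y) ∈ U → ∀ k, F x y * dy k f x y = a x y * m k x y) :
    HomogeneousOn U 0 f where
  smooth := hf
  euler x y hp := by
    apply mul_left_cancel₀ (H.ne_zero hp)
    have h0 := h x y hp 0
    have h1 := h x y hp 1
    have h2 := H.m_coord hp
    linear_combination y 0 * h0 + y 1 * h1 + a x y * h2

theorem metric_symm (H : IsFramedOn U F m e) (h : (x, y) ∈ U) (i j : Fin 2) :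
    metric F x y i j = metric F x y j i := by
  rw [H.metric_eq h, H.metric_eq h]; ring

theorem cartan_swap (H : IsFramedOn U F m e) (h : (x, y) ∈ U) (i j k : Fin 2) :
    cartan F i j k x y = cartan F j i k x y := by
  rw [cartan, cartan, (isDerivationOn_dy H.isOpen k).congr (fun _ _ h => H.metric_symm h i j) h]

theorem cartan_rotate (H : IsFramedOn U F m e) (h : (x, y) ∈ U) (i j k : Fin 2) :
    cartan F i j k x y = cartan F k j i x y := by
  have hL := (H.homogeneous.lagrangian H.isOpen).smooth.dy H.isOpen j
  unfold cartan metric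
  simp only [Matrix.of_apply]
  rw [(isDerivationOn_dy H.isOpen k).const_mul _ (hL.dy H.isOpen i) h,
    (isDerivationOn_dy H.isOpen i).const_mul _ (hL.dy H.isOpen k) h,
    dy_dy_comm H.isOpen hL h i k]

theorem homogeneous_cartan (H : IsFramedOn U F m e) (i j k : Fin 2) :
    HomogeneousOn U (-1) (cartan F i j k) :=
  (((H.homogeneous.metric H.isOpen i j).dy H.isOpen k).const_mul H.isOpen (1 / 2)).congr_deg
    (by norm_num)

/-- A covector that vanishes on the supporting direction `y` is a multiple of `m`. -/
theorem eq_mul_m (H : IsFramedOn U F m e) (h : (x, y) ∈ U) (t : Fin 2 → ℝ)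
    (ht : y 0 * t 0 + y 1 * t 1 = 0) (i : Fin 2) :
    t i = e * (t 0 * up F m 0 x y + t 1 * up F m 1 x y) * m i x y := by
  have h1 := H.covector_eq h t i
  have h2 : t 0 * ellUp F 0 x y + t 1 * ellUp F 1 x y = 0 := by
    have : t 0 * ellUp F 0 x y + t 1 * ellUp F 1 x y = (y 0 * t 0 + y 1 * t 1) / F x y := by
      simp only [ellUp]; ring
    rw [this, ht, zero_div]
  rw [h2] at h1
  linarith

theorem mainScalar_eq (H : IsFramedOn U F m e) (h : (x, y) ∈ U) :
    mainScalar F m x y = e * F x y *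
      ∑ i, ∑ j, ∑ k, cartan F i j k x y * up F m i x y * up F m j x y * up F m k x y := by
  rw [mainScalar, H.eps_eq x y h]

/-- The Cartan tensor of a surface is a multiple of `m ⊗ m ⊗ m`, as it is symmetric and vanishes on
the supporting direction. -/
theorem mul_cartan (H : IsFramedOn U F m e) (h : (x, y) ∈ U) (i j k : Fin 2) :
    F x y * cartan F i j k x y = mainScalar F m x y * m i x y * m j x y * m k x y := by
  have hy (i j : Fin 2) : y 0 * cartan F i j 0 x y + y 1 * cartan F i j 1 x y = 0 := by
    have h1 := (H.homogeneous.metric H.isOpen i j).euler x y h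
    simp only [cartan]
    linear_combination h1 / 2
  have hy2 (i k : Fin 2) : y 0 * cartan F i 0 k x y + y 1 * cartan F i 1 k x y = 0 := by
    rw [H.cartan_rotate h i 0, H.cartan_rotate h i 1, H.cartan_swap h k 0, H.cartan_swap h k 1,
      H.cartan_rotate h 0 k, H.cartan_rotate h 1 k]
    exact hy i k
  have hy1 (j k : Fin 2) : y 0 * cartan F 0 j k x y + y 1 * cartan F 1 j k x y = 0 := by
    rw [H.cartan_rotate h 0, H.cartan_rotate h 1]
    exact hy k j
  have h3 (i j k : Fin 2) := H.eq_mul_m h (fun k => cartan F i j k x y) (hy i j) k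
  have h2 (i j : Fin 2) := H.eq_mul_m h
    (fun j => cartan F i j 0 x y * up F m 0 x y + cartan F i j 1 x y * up F m 1 x y) (by
      linear_combination up F m 0 x y * hy2 i 0 + up F m 1 x y * hy2 i 1) j
  have h1 (i : Fin 2) := H.eq_mul_m h
    (fun i => (cartan F i 0 0 x y * up F m 0 x y + cartan F i 0 1 x y * up F m 1 x y)
        * up F m 0 x y +
      (cartan F i 1 0 x y * up F m 0 x y + cartan F i 1 1 x y * up F m 1 x y) * up F m 1 x y) (by
      linear_combination up F m 0 x y * up F m 0 x y * hy1 0 0 +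
        up F m 0 x y * up F m 1 x y * hy1 0 1 + up F m 0 x y * up F m 1 x y * hy1 1 0
        + up F m 1 x y * up F m 1 x y * hy1 1 1) i
  rw [h3 i j k, h2 i j, h1 i, H.mainScalar_eq h]
  simp only [Fin.sum_univ_two]
  linear_combination (F x y * e * m i x y * m j x y * m k x y *
    (((cartan F 0 0 0 x y * up F m 0 x y + cartan F 0 0 1 x y * up F m 1 x y) * up F m 0 x y +
      (cartan F 0 1 0 x y * up F m 0 x y + cartan F 0 1 1 x y * up F m 1 x y) * up F m 1 x y)
      * up F m 0 x y +
    ((cartan F 1 0 0 x y * up F m 0 x y + cartan F 1 0 1 x y * up F m 1 x y) * up F m 0 x y +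
      (cartan F 1 1 0 x y * up F m 0 x y + cartan F 1 1 1 x y * up F m 1 x y) * up F m 1 x y)
      * up F m 1 x y)) * H.sq_eq_one

/-- The vertical derivative of `m_i`, from that of `g_{ij} = ℓ_i ℓ_j + ε m_i m_j`. -/
theorem mul_dy_m (H : IsFramedOn U F m e) (h : (x, y) ∈ U) (i k : Fin 2) :
    F x y * dy k (m i) x y =
      (e * mainScalar F m x y * m i x y - dy i F x y) * m k x y := by
  have hl := fun i => H.homogeneous.smooth.dy H.isOpen i
  have hD := isDerivationOn_dy H.isOpen k
  -- The defect `z` of the claim satisfies `z_i m_j + m_i z_j = 0`.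
  set z : Fin 2 → ℝ := fun i => F x y * dy k (m i) x y -
      (e * mainScalar F m x y * m i x y - dy i F x y) * m k x y with hz
  have hzz (i j : Fin 2) : z i * m j x y + m i x y * z j = 0 := by
    have h1 : 2 * cartan F i j k x y = dy k (fun x y => metric F x y i j) x y := by
      rw [cartan]; ring
    rw [hD.congr (g := fun x y => dy i F x y * dy j F x y + e * (m i x y * m j x y))
      (fun x y h => by rw [H.metric_eq h]; ring) h,
      hD.add ((hl i).mul (hl j)) ((smoothOn_const e).mul ((H.smooth i).mul (H.smooth j))) h,
      hD.mul (hl i) (hl j) h, hD.const_mul e ((H.smooth i).mul (H.smooth j)) h,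
      hD.mul (H.smooth i) (H.smooth j) h] at h1
    have h2 := H.mul_cartan h i j k
    have h3 := H.mul_dy_dy h k i
    have h4 := H.mul_dy_dy h k j
    simp only [hz]
    linear_combination -e * F x y * h1 + 2 * e * h2 - e * dy j F x y * h3 - e * dy i F x y * h4
      - (F x y * dy k (m i) x y * m j x y + F x y * dy k (m j) x y * m i x y
        + dy i F x y * m k x y * m j x y
        + dy j F x y * m k x y * m i x y) * H.sq_eq_one
  have h1 := H.m_up h
  have h2 : z 0 * up F m 0 x y + z 1 * up F m 1 x y = 0 := by
    apply mul_left_cancel₀ H.e_ne_zero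
    linear_combination (-(z 0 * up F m 0 x y + z 1 * up F m 1 x y)) * h1
      + (up F m 0 x y * up F m 0 x y * hzz 0 0 + up F m 0 x y * up F m 1 x y * hzz 0 1
        + up F m 1 x y * up F m 0 x y * hzz 1 0 + up F m 1 x y * up F m 1 x y * hzz 1 1) / 2
  have h3 : z i = 0 := by
    apply mul_left_cancel₀ H.e_ne_zero
    linear_combination -z i * h1 - m i x y * h2 + up F m 0 x y * hzz i 0 + up F m 1 x y * hzz i 1
  simp only [hz] at h3
  linarith

theorem smooth_ellUp (H : IsFramedOn U F m e) (i : Fin 2) : SmoothOn U (ellUp F i) :=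
  ((smoothOn_coord i).mul (H.homogeneous.smooth.inv fun _ _ h => H.ne_zero h)).congr
    fun _ _ _ => div_eq_mul_inv _ _

theorem mul_dy_ellUp (H : IsFramedOn U F m e) (h : (x, y) ∈ U) (i k : Fin 2) :
    F x y * dy k (ellUp F i) x y = e * up F m i x y * m k x y := by
  have h1 := (isDerivationOn_dy H.isOpen k).mul_apply_of_mul_eq (b := fun _ y => y i)
    H.homogeneous.smooth (H.smooth_ellUp i)
    (fun x y h => mul_div_cancel₀ (y i) (H.ne_zero h)) h
  have h2 := H.covector_eq h (fun j => if j = i then 1 else 0) k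
  rw [h1, dy_coord]
  fin_cases i <;> simp at h2 ⊢ <;> linear_combination h2

/-- The vertical derivative of `m^i`, from `ℓ_i m^i = 0` and `m_i m^i = ε`. -/
theorem mul_dy_up (H : IsFramedOn U F m e) (h : (x, y) ∈ U) (i k : Fin 2) :
    F x y * dy k (up F m i) x y =
      -(ellUp F i x y + e * mainScalar F m x y * up F m i x y) * m k x y := by
  have hl := fun i => H.homogeneous.smooth.dy H.isOpen i
  have hu := H.smooth_up
  have hD := isDerivationOn_dy H.isOpen k
  have h1 := hD.congr (fun x y h => H.ell_up h) h
  rw [hD.add ((hl 0).mul (hu 0)) ((hl 1).mul (hu 1)) h, hD.mul (hl 0) (hu 0) h,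
    hD.mul (hl 1) (hu 1) h, hD.const 0 h] at h1
  have h2 := hD.congr (fun x y h => H.m_up h) h
  rw [hD.add ((H.smooth 0).mul (hu 0)) ((H.smooth 1).mul (hu 1)) h, hD.mul (H.smooth 0) (hu 0) h,
    hD.mul (H.smooth 1) (hu 1) h, hD.const e h] at h2
  have l0 := H.mul_dy_dy h k 0
  have l1 := H.mul_dy_dy h k 1
  have m0 := H.mul_dy_m h 0 k
  have m1 := H.mul_dy_m h 1 k
  have c1 := H.ell_up h
  have c2 := H.m_up h
  have c3 := H.ell_ellUp h
  have c4 := H.m_ellUp h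
  refine H.vector_ext h (v := fun i => F x y * dy k (up F m i) x y)
    (w := fun i => -(ellUp F i x y + e * mainScalar F m x y * up F m i x y) * m k x y) ?_ ?_ i
  · linear_combination F x y * h1 - up F m 0 x y * l0 - up F m 1 x y * l1
      - e * m k x y * c2 + m k x y * c3 + e * mainScalar F m x y * m k x y * c1
      - m k x y * H.sq_eq_one
  · linear_combination F x y * h2 - up F m 0 x y * m0 - up F m 1 x y * m1
      + m k x y * c4 + m k x y * c1

theorem homogeneous_ellUp (H : IsFramedOn U F m e) (i : Fin 2) : HomogeneousOn U 0 (ellUp F i) :=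
  H.homogeneous_of_mul_dy (H.smooth_ellUp i) _ fun _ _ h k => H.mul_dy_ellUp h i k

theorem homogeneous_up (H : IsFramedOn U F m e) (i : Fin 2) : HomogeneousOn U 0 (up F m i) :=
  H.homogeneous_of_mul_dy (H.smooth_up i) _ fun _ _ h k => H.mul_dy_up h i k

theorem homogeneous_v2 (H : IsFramedOn U F m e) {n : ℝ} {f : CoordFn} (hf : HomogeneousOn U n f) :
    HomogeneousOn U n (v2 F m f) := by
  have h (i) := ((hf.dy H.isOpen i).mul H.isOpen (H.homogeneous_up i))
  exact (((((h 0).add H.isOpen (h 1)).mul H.isOpen H.homogeneous).const_mul H.isOpen e).congr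
    H.isOpen fun x y h => by rw [H.v2_eq h]; ring).congr_deg (by ring)

theorem homogeneous_mainScalar (H : IsFramedOn U F m e) : HomogeneousOn U 0 (mainScalar F m) := by
  have hU := H.isOpen
  have h (i j k) := (((H.homogeneous_cartan i j k).mul hU (H.homogeneous_up i)).mul hU
    (H.homogeneous_up j)).mul hU (H.homogeneous_up k)
  have hs := ((((h 0 0 0).add hU (h 0 0 1)).add hU ((h 0 1 0).add hU (h 0 1 1))).add hU
    (((h 1 0 0).add hU (h 1 0 1)).add hU ((h 1 1 0).add hU (h 1 1 1))))
  exact (((H.homogeneous.const_mul hU e).mul hU hs).congr hU fun x y h => by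
    rw [H.mainScalar_eq h]; simp only [Fin.sum_univ_two]).congr_deg (by ring)

end IsFramedOn

/-- The vector field `a ℓ^i + b m^i`. -/
def frameVector (F : CoordFn) (m : Fin 2 → CoordFn) (a b : CoordFn) (i : Fin 2) : CoordFn :=
  fun x y => a x y * ellUp F i x y + b x y * up F m i x y

/-- The component along `ℓ^i` of the `;2`-derivative of `a ℓ^i + b m^i`, the coefficient of `m_k` in
`F ∂̇_k (a ℓ^i + b m^i)`. -/
def nablaP (F : CoordFn) (m : Fin 2 → CoordFn) (a b : CoordFn) : CoordFn :=
  fun x y => v2 F m a x y - b x y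

/-- The component along `m^i` of the `;2`-derivative of `a ℓ^i + b m^i`, the coefficient of `m_k` in
`F ∂̇_k (a ℓ^i + b m^i)`. -/
def nablaQ (F : CoordFn) (m : Fin 2 → CoordFn) (e : ℝ) (a b : CoordFn) : CoordFn :=
  fun x y => v2 F m b x y + e * a x y - e * (mainScalar F m x y * b x y)

namespace IsFramedOn

theorem homogeneous_frameVector (H : IsFramedOn U F m e) {n : ℝ} {a b : CoordFn}
    (ha : HomogeneousOn U n a) (hb : HomogeneousOn U n b) (i : Fin 2) :
    HomogeneousOn U n (frameVector F m a b i) :=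
  ((ha.mul H.isOpen (H.homogeneous_ellUp i)).add H.isOpen
    (hb.mul H.isOpen (H.homogeneous_up i))).congr_deg (add_zero n)

theorem homogeneous_nablaP (H : IsFramedOn U F m e) {n : ℝ} {a b : CoordFn}
    (ha : HomogeneousOn U n a) (hb : HomogeneousOn U n b) :
    HomogeneousOn U n (nablaP F m a b) :=
  (H.homogeneous_v2 ha).sub H.isOpen hb

theorem homogeneous_nablaQ (H : IsFramedOn U F m e) {n : ℝ} {a b : CoordFn}
    (ha : HomogeneousOn U n a) (hb : HomogeneousOn U n b) :
    HomogeneousOn U n (nablaQ F m e a b) :=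
  ((H.homogeneous_v2 hb).add H.isOpen (ha.const_mul H.isOpen e)).sub H.isOpen
    (((H.homogeneous_mainScalar.mul H.isOpen hb).congr_deg (zero_add n)).const_mul H.isOpen e)

theorem mul_dy_frameVector (H : IsFramedOn U F m e) {n : ℝ} {a b : CoordFn}
    (ha : HomogeneousOn U n a) (hb : HomogeneousOn U n b) (h : (x, y) ∈ U) (i k : Fin 2) :
    F x y * dy k (frameVector F m a b i) x y = n * frameVector F m a b i x y * dy k F x y
      + frameVector F m (nablaP F m a b) (nablaQ F m e a b) i x y * m k x y := by
  have hD := isDerivationOn_dy H.isOpen k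
  have h1 := H.smooth_ellUp i
  have h2 := H.smooth_up i
  unfold frameVector nablaP nablaQ
  rw [hD.add (ha.smooth.mul h1) (hb.smooth.mul h2) h, hD.mul ha.smooth h1 h,
    hD.mul hb.smooth h2 h]
  linear_combination ellUp F i x y * H.mul_dy ha h k + up F m i x y * H.mul_dy hb h k
    + a x y * H.mul_dy_ellUp h i k + b x y * H.mul_dy_up h i k

end IsFramedOn

/-! ### Third vertical derivatives of a vector field of degree two -/

variable {a b : CoordFn}

/-- The component along `ℓ^i` of the coefficient of `m_j m_k` in the second vertical derivative of
the vector field `a ℓ^i + b m^i` of degree `2`. -/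
def secondP (F : CoordFn) (m : Fin 2 → CoordFn) (e : ℝ) (a b : CoordFn) : CoordFn := fun x y =>
  2 * e * a x y + nablaP F m (nablaP F m a b) (nablaQ F m e a b) x y
    + e * (mainScalar F m x y * nablaP F m a b x y)

/-- The component along `m^i` of the coefficient of `m_j m_k` in the second vertical derivative of
the vector field `a ℓ^i + b m^i` of degree `2`. -/
def secondQ (F : CoordFn) (m : Fin 2 → CoordFn) (e : ℝ) (a b : CoordFn) : CoordFn := fun x y =>
  2 * e * b x y + nablaQ F m e (nablaP F m a b) (nablaQ F m e a b) x y
    + e * (mainScalar F m x y * nablaQ F m e a b x y)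

namespace IsFramedOn

theorem sq_mul_dy_dy_frameVector (H : IsFramedOn U F m e) (ha : HomogeneousOn U 2 a)
    (hb : HomogeneousOn U 2 b) (h : (x, y) ∈ U) (i j k : Fin 2) :
    F x y ^ 2 * dy j (dy k (frameVector F m a b i)) x y =
      2 * frameVector F m a b i x y * dy j F x y * dy k F x y
      + frameVector F m (nablaP F m a b) (nablaQ F m e a b) i x y
        * (dy k F x y * m j x y + dy j F x y * m k x y)
      + frameVector F m
          (secondP F m e a b)
          (secondQ F m e a b) i x y * m j x y * m k x y := by
  have hD := isDerivationOn_dy H.isOpen j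
  have ha' := H.homogeneous_nablaP ha hb
  have hb' := H.homogeneous_nablaQ ha hb
  have hV := H.homogeneous_frameVector ha hb i
  have hW := H.homogeneous_frameVector ha' hb' i
  have h1 := hD.mul_apply_of_mul_eq H.homogeneous.smooth (hV.smooth.dy H.isOpen k)
    (b := fun x y => 2 * (frameVector F m a b i x y * dy k F x y)
      + frameVector F m (nablaP F m a b) (nablaQ F m e a b) i x y * m k x y)
    (fun x y h => by rw [H.mul_dy_frameVector ha hb h i k]; ring) h
  have hl := H.homogeneous.smooth.dy H.isOpen k
  rw [hD.add ((smoothOn_const 2).mul (hV.smooth.mul hl)) (hW.smooth.mul (H.smooth k)) h,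
    hD.const_mul 2 (hV.smooth.mul hl) h, hD.mul hV.smooth hl h,
    hD.mul hW.smooth (H.smooth k) h] at h1
  have h2 := H.mul_dy_frameVector ha hb h i j
  have h3 := H.mul_dy_frameVector ha' hb' h i j
  have h4 := H.mul_dy_dy h j k
  have h5 := H.mul_dy_m h k j
  have h6 := H.mul_dy_frameVector ha hb h i k
  have h7 : frameVector F m
          (secondP F m e a b)
          (secondQ F m e a b) i x y =
      2 * e * frameVector F m a b i x y
      + frameVector F m (nablaP F m (nablaP F m a b) (nablaQ F m e a b))
          (nablaQ F m e (nablaP F m a b) (nablaQ F m e a b)) i x y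
      + e * (mainScalar F m x y
        * frameVector F m (nablaP F m a b) (nablaQ F m e a b) i x y) := by
    simp only [frameVector, secondP, secondQ]; ring
  rw [h7]
  generalize frameVector F m a b i = V at *
  generalize frameVector F m (nablaP F m a b) (nablaQ F m e a b) i = W at *
  linear_combination F x y * h1 + 2 * dy k F x y * h2 + m k x y * h3 + 2 * V x y * h4
    + W x y * h5 - dy j F x y * h6

theorem homogeneous_secondP (H : IsFramedOn U F m e) {n : ℝ} (ha : HomogeneousOn U n a)
    (hb : HomogeneousOn U n b) : HomogeneousOn U n (secondP F m e a b) :=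
  have h1 := H.homogeneous_nablaP ha hb
  ((ha.const_mul H.isOpen (2 * e)).add H.isOpen
    (H.homogeneous_nablaP h1 (H.homogeneous_nablaQ ha hb))).add H.isOpen
    (((H.homogeneous_mainScalar.mul H.isOpen h1).congr_deg (zero_add n)).const_mul H.isOpen e)

theorem homogeneous_secondQ (H : IsFramedOn U F m e) {n : ℝ} (ha : HomogeneousOn U n a)
    (hb : HomogeneousOn U n b) : HomogeneousOn U n (secondQ F m e a b) :=
  have h1 := H.homogeneous_nablaQ ha hb
  ((hb.const_mul H.isOpen (2 * e)).add H.isOpen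
    (H.homogeneous_nablaQ (H.homogeneous_nablaP ha hb) h1)).add H.isOpen
    (((H.homogeneous_mainScalar.mul H.isOpen h1).congr_deg (zero_add n)).const_mul H.isOpen e)

theorem v2_nablaP (H : IsFramedOn U F m e) (ha : SmoothOn U (v2 F m a)) (hb : SmoothOn U b)
    (h : (x, y) ∈ U) : v2 F m (nablaP F m a b) x y = v2 F m (v2 F m a) x y - v2 F m b x y :=
  (isDerivationOn_v2 H.isOpen).sub ha hb h

theorem v2_nablaQ (H : IsFramedOn U F m e) (ha : SmoothOn U a) (hb : SmoothOn U b)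
    (hb' : SmoothOn U (v2 F m b)) (h : (x, y) ∈ U) :
    v2 F m (nablaQ F m e a b) x y = v2 F m (v2 F m b) x y + e * v2 F m a x y
      - e * (v2 F m (mainScalar F m) x y * b x y + mainScalar F m x y * v2 F m b x y) := by
  have hD := isDerivationOn_v2 (F := F) (m := m) H.isOpen
  have hI := H.homogeneous_mainScalar.smooth
  unfold nablaQ
  rw [hD.sub (hb'.add ((smoothOn_const e).mul ha)) ((smoothOn_const e).mul (hI.mul hb)) h,
    hD.add hb' ((smoothOn_const e).mul ha) h, hD.const_mul e ha h, hD.const_mul e (hI.mul hb) h,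
    hD.mul hI hb h]

theorem secondP_eq (H : IsFramedOn U F m e) (ha : HomogeneousOn U 2 a)
    (hb : HomogeneousOn U 2 b) (h : (x, y) ∈ U) :
    secondP F m e a b x y =
      v2 F m (v2 F m a) x y - 2 * v2 F m b x y + e * a x y
        + e * (mainScalar F m x y * v2 F m a x y) := by
  rw [secondP, nablaP, H.v2_nablaP (H.homogeneous_v2 ha).smooth hb.smooth h, nablaP, nablaQ]
  ring

theorem secondQ_eq (H : IsFramedOn U F m e) (ha : HomogeneousOn U 2 a)
    (hb : HomogeneousOn U 2 b) (h : (x, y) ∈ U) :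
    secondQ F m e a b x y =
      v2 F m (v2 F m b) x y + 2 * e * v2 F m a x y + e * b x y
        - e * (v2 F m (mainScalar F m) x y * b x y) - e * (mainScalar F m x y * v2 F m b x y) := by
  rw [secondQ, nablaQ, H.v2_nablaQ ha.smooth hb.smooth (H.homogeneous_v2 hb).smooth h, nablaP,
    nablaQ]
  ring

theorem v2_secondP (H : IsFramedOn U F m e) (ha : HomogeneousOn U 2 a)
    (hb : HomogeneousOn U 2 b) (h : (x, y) ∈ U) :
    v2 F m (secondP F m e a b) x y =
      v2 F m (v2 F m (v2 F m a)) x y - 2 * v2 F m (v2 F m b) x y + e * v2 F m a x y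
        + e * (v2 F m (mainScalar F m) x y * v2 F m a x y
          + mainScalar F m x y * v2 F m (v2 F m a) x y) := by
  have hD := isDerivationOn_v2 (F := F) (m := m) H.isOpen
  have hI := H.homogeneous_mainScalar.smooth
  have ha1 := H.homogeneous_v2 ha
  have ha2 := (H.homogeneous_v2 ha1).smooth
  have hb1 := (H.homogeneous_v2 hb).smooth
  have c (t : ℝ) : SmoothOn U fun _ _ => t := smoothOn_const t
  rw [hD.congr (fun x y h => H.secondP_eq ha hb h) h,
    hD.add ((ha2.sub ((c 2).mul hb1)).add ((c e).mul ha.smooth))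
      ((c e).mul (hI.mul ha1.smooth)) h,
    hD.add (ha2.sub ((c 2).mul hb1)) ((c e).mul ha.smooth) h,
    hD.sub ha2 ((c 2).mul hb1) h, hD.const_mul 2 hb1 h, hD.const_mul e ha.smooth h,
    hD.const_mul e (hI.mul ha1.smooth) h, hD.mul hI ha1.smooth h]

theorem v2_secondQ (H : IsFramedOn U F m e) (ha : HomogeneousOn U 2 a)
    (hb : HomogeneousOn U 2 b) (h : (x, y) ∈ U) :
    v2 F m (secondQ F m e a b) x y =
      v2 F m (v2 F m (v2 F m b)) x y + 2 * e * v2 F m (v2 F m a) x y + e * v2 F m b x y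
        - e * (v2 F m (v2 F m (mainScalar F m)) x y * b x y
          + v2 F m (mainScalar F m) x y * v2 F m b x y)
        - e * (v2 F m (mainScalar F m) x y * v2 F m b x y
          + mainScalar F m x y * v2 F m (v2 F m b) x y) := by
  have hD := isDerivationOn_v2 (F := F) (m := m) H.isOpen
  have hI := H.homogeneous_mainScalar.smooth
  have hI1 := (H.homogeneous_v2 H.homogeneous_mainScalar).smooth
  have ha1 := (H.homogeneous_v2 ha).smooth
  have hb1 := H.homogeneous_v2 hb
  have hb2 := (H.homogeneous_v2 hb1).smooth
  have c (t : ℝ) : SmoothOn U fun _ _ => t := smoothOn_const t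
  have s1 := hb2.add ((c (2 * e)).mul ha1)
  have s2 := s1.add ((c e).mul hb.smooth)
  have s3 := s2.sub ((c e).mul (hI1.mul hb.smooth))
  rw [hD.congr (fun x y h => H.secondQ_eq ha hb h) h,
    hD.sub s3 ((c e).mul (hI.mul hb1.smooth)) h, hD.sub s2 ((c e).mul (hI1.mul hb.smooth)) h,
    hD.add s1 ((c e).mul hb.smooth) h, hD.add hb2 ((c (2 * e)).mul ha1) h,
    hD.const_mul (2 * e) ha1 h, hD.const_mul e hb.smooth h,
    hD.const_mul e (hI1.mul hb.smooth) h, hD.mul hI1 hb.smooth h,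
    hD.const_mul e (hI.mul hb1.smooth) h, hD.mul hI hb1.smooth h]

/-- The third vertical derivative of a vector field of degree `2` is a vector multiple of
`m ⊗ m ⊗ m`. -/
theorem cube_mul_dy_dy_dy_frameVector (H : IsFramedOn U F m e) (ha : HomogeneousOn U 2 a)
    (hb : HomogeneousOn U 2 b) (h : (x, y) ∈ U) (i j k r : Fin 2) :
    F x y ^ 3 * dy r (dy j (dy k (frameVector F m a b i))) x y =
      (((-3 + v2 F m (mainScalar F m) x y) * e * b x y
          + (1 + v2 F m (mainScalar F m) x y + 2 * e * mainScalar F m x y ^ 2) * e * v2 F m a x y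
          + v2 F m (v2 F m (v2 F m a)) x y - 3 * v2 F m (v2 F m b) x y
          + 3 * e * mainScalar F m x y * v2 F m (v2 F m a) x y
          - 3 * e * mainScalar F m x y * v2 F m b x y
          + 2 * mainScalar F m x y * a x y) * ellUp F i x y
        + (3 * a x y
          - (mainScalar F m x y + e * v2 F m (v2 F m (mainScalar F m)) x y
            + mainScalar F m x y * v2 F m (mainScalar F m) x y) * b x y
          - (2 * e * v2 F m (mainScalar F m) x y + mainScalar F m x y ^ 2 - e) * v2 F m b x y
          + 3 * e * v2 F m (v2 F m a) x y + v2 F m (v2 F m (v2 F m b)) x y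
          + 3 * mainScalar F m x y * v2 F m a x y) * up F m i x y)
      * m j x y * m k x y * m r x y := by
  have hD := isDerivationOn_dy H.isOpen r
  have ha1 := H.homogeneous_nablaP ha hb
  have hb1 := H.homogeneous_nablaQ ha hb
  have hYa := H.homogeneous_secondP ha hb
  have hYb := H.homogeneous_secondQ ha hb
  have hV := H.homogeneous_frameVector ha hb i
  have hW := H.homogeneous_frameVector ha1 hb1 i
  have hY := H.homogeneous_frameVector hYa hYb i
  have hF := H.homogeneous.smooth
  have hl := fun j => hF.dy H.isOpen j
  have hm := H.smooth
  have h1 := hD.mul_apply_of_mul_eq (hF.mul hF) ((hV.smooth.dy H.isOpen k).dy H.isOpen j)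
    (b := fun x y => 2 * (frameVector F m a b i x y * (dy j F x y * dy k F x y))
      + frameVector F m (nablaP F m a b) (nablaQ F m e a b) i x y
        * (dy k F x y * m j x y + dy j F x y * m k x y)
      + frameVector F m
          (secondP F m e a b)
          (secondQ F m e a b) i x y * (m j x y * m k x y))
    (fun x y h => by linear_combination H.sq_mul_dy_dy_frameVector ha hb h i j k) h
  have s1 := (smoothOn_const 2).mul (hV.smooth.mul ((hl j).mul (hl k)))
  have s2 := ((hl k).mul (hm j)).add ((hl j).mul (hm k))
  have s3 := (hm j).mul (hm k)
  rw [hD.add (s1.add (hW.smooth.mul s2)) (hY.smooth.mul s3) h, hD.add s1 (hW.smooth.mul s2) h,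
    hD.const_mul 2 (hV.smooth.mul ((hl j).mul (hl k))) h, hD.mul hV.smooth ((hl j).mul (hl k)) h,
    hD.mul (hl j) (hl k) h, hD.mul hW.smooth s2 h,
    hD.add ((hl k).mul (hm j)) ((hl j).mul (hm k)) h, hD.mul (hl k) (hm j) h,
    hD.mul (hl j) (hm k) h, hD.mul hY.smooth s3 h, hD.mul (hm j) (hm k) h, hD.mul hF hF h] at h1
  have h0 := H.sq_mul_dy_dy_frameVector ha hb h i j k
  have dV := H.mul_dy_frameVector ha hb h i r
  have dW := H.mul_dy_frameVector ha1 hb1 h i r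
  have dY := H.mul_dy_frameVector hYa hYb h i r
  have lj := H.mul_dy_dy h r j
  have lk := H.mul_dy_dy h r k
  have mj := H.mul_dy_m h j r
  have mk := H.mul_dy_m h k r
  have eY : frameVector F m
          (secondP F m e a b)
          (secondQ F m e a b) i x y =
      2 * e * frameVector F m a b i x y
      + frameVector F m (nablaP F m (nablaP F m a b) (nablaQ F m e a b))
          (nablaQ F m e (nablaP F m a b) (nablaQ F m e a b)) i x y
      + e * (mainScalar F m x y
        * frameVector F m (nablaP F m a b) (nablaQ F m e a b) i x y) := by
    simp only [frameVector, secondP, secondQ]; ring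
  -- The terms with a factor `ℓ_j`, `ℓ_k` or `ℓ_r` cancel: the second derivatives have degree `0`,
  -- so the third ones vanish on `y`.
  have key : F x y ^ 3 * dy r (dy j (dy k (frameVector F m a b i))) x y =
      (2 * e * frameVector F m (nablaP F m a b) (nablaQ F m e a b) i x y
      + frameVector F m
        (nablaP F m
          (secondP F m e a b)
          (secondQ F m e a b))
        (nablaQ F m e
          (secondP F m e a b)
          (secondQ F m e a b)) i x y
      + 2 * e * mainScalar F m x y * frameVector F m
          (secondP F m e a b)
          (secondQ F m e a b) i x y)
      * m j x y * m k x y * m r x y := by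
    generalize frameVector F m
        (nablaP F m
          (secondP F m e a b)
          (secondQ F m e a b))
        (nablaQ F m e
          (secondP F m e a b)
          (secondQ F m e a b)) i = Z at *
    generalize frameVector F m
          (secondP F m e a b)
          (secondQ F m e a b) i = Y at *
    generalize frameVector F m (nablaP F m (nablaP F m a b) (nablaQ F m e a b))
          (nablaQ F m e (nablaP F m a b) (nablaQ F m e a b)) i = X at *
    generalize frameVector F m (nablaP F m a b) (nablaQ F m e a b) i = W at *
    generalize frameVector F m a b i = V at *
    linear_combination F x y * h1 - 2 * dy r F x y * h0
      + (2 * dy j F x y * dy k F x y) * dV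
      + 2 * V x y * (dy k F x y * lj + dy j F x y * lk)
      + (dy k F x y * m j x y + dy j F x y * m k x y) * dW
      + W x y * (m j x y * lk + dy k F x y * mj + m k x y * lj + dy j F x y * mk)
      + m j x y * m k x y * dY + Y x y * (m k x y * mj + m j x y * mk)
      - (dy k F x y * m j x y + dy j F x y * m k x y) * m r x y * eY
  have h2 := H.sq_eq_one
  set I := mainScalar F m
  have hA : 2 * e * nablaP F m a b x y
      + nablaP F m (secondP F m e a b) (secondQ F m e a b) x y
      + 2 * e * I x y * secondP F m e a b x y =
      (-3 + v2 F m I x y) * e * b x y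
          + (1 + v2 F m I x y + 2 * e * I x y ^ 2) * e * v2 F m a x y
          + v2 F m (v2 F m (v2 F m a)) x y - 3 * v2 F m (v2 F m b) x y
          + 3 * e * I x y * v2 F m (v2 F m a) x y
          - 3 * e * I x y * v2 F m b x y + 2 * I x y * a x y := by
    rw [nablaP, nablaP, H.v2_secondP ha hb h, H.secondP_eq ha hb h, H.secondQ_eq ha hb h]
    linear_combination (2 * I x y * a x y) * h2
  have hB : 2 * e * nablaQ F m e a b x y
      + nablaQ F m e (secondP F m e a b) (secondQ F m e a b) x y
      + 2 * e * I x y * secondQ F m e a b x y =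
      3 * a x y - (I x y + e * v2 F m (v2 F m I) x y + I x y * v2 F m I x y) * b x y
          - (2 * e * v2 F m I x y + I x y ^ 2 - e) * v2 F m b x y
          + 3 * e * v2 F m (v2 F m a) x y + v2 F m (v2 F m (v2 F m b)) x y
          + 3 * I x y * v2 F m a x y := by
    rw [nablaQ, nablaQ, H.v2_secondQ ha hb h, H.secondP_eq ha hb h, H.secondQ_eq ha hb h]
    linear_combination (3 * a x y - I x y * b x y + 3 * I x y * v2 F m a x y
      - I x y * v2 F m I x y * b x y - I x y ^ 2 * v2 F m b x y) * h2
  rw [key, ← hA, ← hB]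
  simp only [frameVector]
  ring

end IsFramedOn

/-! ### The geodesic spray and the conformal change -/

/-- The Euler–Lagrange expression `y^k ∂_k ∂̇_j f - ∂_j f`. -/
def eulerLagrange (j : Fin 2) (f : CoordFn) : CoordFn := fun x y =>
  (∑ k, y k * dx k (dy j f) x y) - dx j f x y

theorem spray_eq_mulVec (F : CoordFn) (x y : Plane) :
    (fun i => spray F i x y) = (1 / 4 : ℝ) •
      Matrix.mulVec (metric F x y)⁻¹ (fun j => eulerLagrange j (lagrangian F) x y) := by
  funext i
  simp only [spray, eulerLagrange, Matrix.mulVec, dotProduct, Pi.smul_apply, smul_eq_mul]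

/-- The spray coefficients are the solution of the Euler–Lagrange equations. -/
theorem four_mul_metric_spray {F : CoordFn} {x y : Plane} (h : (metric F x y).det ≠ 0) (j : Fin 2) :
    4 * (metric F x y j 0 * spray F 0 x y + metric F x y j 1 * spray F 1 x y) =
      eulerLagrange j (lagrangian F) x y := by
  have h1 := congrArg (Matrix.mulVec (metric F x y)) (spray_eq_mulVec F x y)
  rw [Matrix.mulVec_smul, Matrix.mulVec_mulVec, Matrix.mul_nonsing_inv _ (isUnit_iff_ne_zero.2 h),
    Matrix.one_mulVec] at h1
  have h2 := congrFun h1 j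
  simp only [Matrix.mulVec, dotProduct, Fin.sum_univ_two, Pi.smul_apply, smul_eq_mul] at h2
  linarith

theorem eq_spray {F : CoordFn} {x y : Plane} (h : (metric F x y).det ≠ 0) {v : Fin 2 → ℝ}
    (hv : ∀ j, 4 * (metric F x y j 0 * v 0 + metric F x y j 1 * v 1) =
      eulerLagrange j (lagrangian F) x y) (i : Fin 2) : spray F i x y = v i := by
  have h1 : Matrix.mulVec (metric F x y) v =
      (1 / 4 : ℝ) • fun j => eulerLagrange j (lagrangian F) x y := by
    funext j
    have := hv j
    simp only [Matrix.mulVec, dotProduct, Fin.sum_univ_two, Pi.smul_apply, smul_eq_mul]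
    linarith
  have h2 := spray_eq_mulVec F x y
  rw [← Matrix.mulVec_smul, ← h1, Matrix.mulVec_mulVec,
    Matrix.nonsing_inv_mul _ (isUnit_iff_ne_zero.2 h), Matrix.one_mulVec] at h2
  exact congrFun h2 i

/-- The derivative `S f = y^k ∂_k f - 2 G^k ∂̇_k f` along the geodesic spray of `F`. -/
def sprayDeriv (F : CoordFn) (f : CoordFn) : CoordFn := fun x y =>
  y 0 * dx 0 f x y + y 1 * dx 1 f x y
    - 2 * (spray F 0 x y * dy 0 f x y + spray F 1 x y * dy 1 f x y)

theorem isDerivationOn_sprayDeriv {U : Set (Plane × Plane)} (hU : IsOpen U) (F : CoordFn) :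
    IsDerivationOn U (sprayDeriv F) :=
  ((((isDerivationOn_dx hU 0).smul fun _ y => y 0).add_op
    ((isDerivationOn_dx hU 1).smul fun _ y => y 1)).add_op
    (((isDerivationOn_dy hU 0).smul fun x y => -2 * spray F 0 x y).add_op
    ((isDerivationOn_dy hU 1).smul fun x y => -2 * spray F 1 x y))).of_eq
    fun f x y => by rw [sprayDeriv]; ring

theorem delta_eq (F : CoordFn) (i : Fin 2) (f : CoordFn) (x y : Plane) :
    delta F i f x y = dx i f x y
      - (dy i (spray F 0) x y * dy 0 f x y + dy i (spray F 1) x y * dy 1 f x y) := by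
  rw [delta, Fin.sum_univ_two]; rfl

theorem isDerivationOn_delta {U : Set (Plane × Plane)} (hU : IsOpen U) (F : CoordFn) (i : Fin 2) :
    IsDerivationOn U (delta F i) :=
  ((isDerivationOn_dx hU i).add_op
    (((isDerivationOn_dy hU 0).smul fun x y => -dy i (spray F 0) x y).add_op
    ((isDerivationOn_dy hU 1).smul fun x y => -dy i (spray F 1) x y))).of_eq
    fun f x y => by rw [delta_eq]; ring

theorem HomogeneousOn.eulerLagrange (hU : IsOpen U) {n : ℝ} {f : CoordFn} (hf : HomogeneousOn U n f)
    (j : Fin 2) : HomogeneousOn U n (eulerLagrange j f) := by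
  have h (k : Fin 2) := ((HomogeneousOn.coord k).mul hU ((hf.dy hU j).dx hU k)).congr_deg
    (show 1 + (n - 1) = n by ring)
  refine (((h 0).add hU (h 1)).sub hU (hf.dx hU j)).congr hU fun x y _ => ?_
  rw [FinslerSurface.eulerLagrange, Fin.sum_univ_two]

namespace IsFramedOn

theorem homogeneous_spray (H : IsFramedOn U F m e) (i : Fin 2) : HomogeneousOn U 2 (spray F i) := by
  have hU := H.isOpen
  have hg := H.homogeneous.metric hU
  have hd : HomogeneousOn U 0 fun x y => (metric F x y).det :=
    ((((hg 0 0).mul hU (hg 1 1)).sub hU ((hg 0 1).mul hU (hg 1 0))).congr hU fun x y _ => by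
      rw [Matrix.det_fin_two]).congr_deg (by ring)
  have hE := (H.homogeneous.lagrangian hU).eulerLagrange hU
  have hd' := hd.inv hU H.det_ne_zero
  have key (a b : CoordFn) (ha : HomogeneousOn U 0 a) (hb : HomogeneousOn U 0 b) :
      HomogeneousOn U 2 fun x y => (1 / 4) * ((metric F x y).det⁻¹ *
        (a x y * eulerLagrange 0 (lagrangian F) x y
          + b x y * eulerLagrange 1 (lagrangian F) x y)) :=
    ((hd'.mul hU ((ha.mul hU (hE 0)).add hU (hb.mul hU (hE 1)))).const_mul hU
      (1 / 4)).congr_deg (by ring)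
  have hs (x y : Plane) := congrFun (spray_eq_mulVec F x y) i
  fin_cases i
  · refine (key _ _ (hg 1 1) ((hg 0 1).const_mul hU (-1))).congr hU fun x y h => ?_
    refine (hs x y).trans ?_
    rw [inv_metric]
    simp [Matrix.vecHead, Matrix.vecTail]
    ring
  · refine (key _ _ ((hg 1 0).const_mul hU (-1)) (hg 0 0)).congr hU fun x y h => ?_
    refine (hs x y).trans ?_
    rw [inv_metric]
    simp [Matrix.vecHead, Matrix.vecTail]
    ring

theorem homogeneous_sprayDeriv (H : IsFramedOn U F m e) {n : ℝ} {f : CoordFn}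
    (hf : HomogeneousOn U n f) : HomogeneousOn U (n + 1) (sprayDeriv F f) := by
  have hU := H.isOpen
  have h1 (k : Fin 2) := ((HomogeneousOn.coord k).mul hU (hf.dx hU k)).congr_deg (add_comm 1 n)
  have h2 (k : Fin 2) := ((H.homogeneous_spray k).mul hU (hf.dy hU k)).congr_deg
    (show 2 + (n - 1) = n + 1 by ring)
  exact ((h1 0).add hU (h1 1)).sub hU (((h2 0).add hU (h2 1)).const_mul hU 2)

theorem homogeneous_delta (H : IsFramedOn U F m e) {n : ℝ} {f : CoordFn}
    (hf : HomogeneousOn U n f) (i : Fin 2) : HomogeneousOn U n (delta F i f) := by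
  have hU := H.isOpen
  have h2 (k : Fin 2) := (((H.homogeneous_spray k).dy hU i).mul hU (hf.dy hU k)).congr_deg
    (show 2 - 1 + (n - 1) = n by ring)
  exact ((hf.dx hU i).sub hU ((h2 0).add hU (h2 1))).congr hU fun x y _ => delta_eq F i f x y

theorem sprayDeriv_eq (H : IsFramedOn U F m e) (h : (x, y) ∈ U) (f : CoordFn) :
    sprayDeriv F f x y = y 0 * delta F 0 f x y + y 1 * delta F 1 f x y := by
  have h0 := (H.homogeneous_spray 0).euler x y h
  have h1 := (H.homogeneous_spray 1).euler x y h
  rw [sprayDeriv, delta_eq, delta_eq]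
  linear_combination dy 0 f x y * h0 + dy 1 f x y * h1

/-- The Euler–Lagrange expression in terms of the derivatives along the spray of `F`. -/
theorem eulerLagrange_eq (H : IsFramedOn U F m e) (h : (x, y) ∈ U) {f : CoordFn}
    (hf : SmoothOn U f) (j : Fin 2) :
    eulerLagrange j f x y = dy j (sprayDeriv F f) x y - 2 * delta F j f x y
      + 2 * (spray F 0 x y * dy 0 (dy j f) x y + spray F 1 x y * dy 1 (dy j f) x y) := by
  have hU := H.isOpen
  have hD := isDerivationOn_dy hU j
  have hx (k) := hf.dx hU k
  have hy (k) := hf.dy hU k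
  have hG (k) := (H.homogeneous_spray k).smooth
  have hc (k : Fin 2) : SmoothOn U fun _ y => y k := smoothOn_coord k
  rw [delta_eq, eulerLagrange, Fin.sum_univ_two]
  unfold sprayDeriv
  rw [hD.sub (((hc 0).mul (hx 0)).add ((hc 1).mul (hx 1)))
        ((smoothOn_const 2).mul (((hG 0).mul (hy 0)).add ((hG 1).mul (hy 1)))) h,
      hD.add ((hc 0).mul (hx 0)) ((hc 1).mul (hx 1)) h, hD.mul (hc 0) (hx 0) h,
      hD.mul (hc 1) (hx 1) h, hD.const_mul 2 (((hG 0).mul (hy 0)).add ((hG 1).mul (hy 1))) h,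
      hD.add ((hG 0).mul (hy 0)) ((hG 1).mul (hy 1)) h, hD.mul (hG 0) (hy 0) h,
      hD.mul (hG 1) (hy 1) h, dy_coord, dy_coord, ← dx_dy_comm hU hf h, ← dx_dy_comm hU hf h,
      dy_dy_comm hU hf h j 0, dy_dy_comm hU hf h j 1]
  fin_cases j <;> simp <;> ring

end IsFramedOn

theorem dy_dy_lagrangian (F : CoordFn) (x y : Plane) (i j : Fin 2) :
    dy i (dy j (lagrangian F)) x y = 2 * metric F x y i j := by
  rw [metric, Matrix.of_apply]; ring

namespace IsFramedOn

theorem dy_sprayDeriv_lagrangian (H : IsFramedOn U F m e) (h : (x, y) ∈ U) (j : Fin 2) :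
    dy j (sprayDeriv F (lagrangian F)) x y = 2 * delta F j (lagrangian F) x y := by
  have h1 := H.eulerLagrange_eq h (H.homogeneous.lagrangian H.isOpen).smooth j
  have h2 := four_mul_metric_spray (H.det_ne_zero x y h) j
  rw [dy_dy_lagrangian, dy_dy_lagrangian, H.metric_symm h 0 j, H.metric_symm h 1 j] at h1
  linarith

/-- The Lagrangian is a first integral of the geodesic spray: the two sides of
`y^j ∂̇_j (S F²) = 2 y^j δ_j F²` are `3 S F²` and `2 S F²`. -/
theorem sprayDeriv_lagrangian (H : IsFramedOn U F m e) (h : (x, y) ∈ U) :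
    sprayDeriv F (lagrangian F) x y = 0 := by
  have h1 := (H.homogeneous_sprayDeriv (H.homogeneous.lagrangian H.isOpen)).euler x y h
  rw [H.dy_sprayDeriv_lagrangian h, H.dy_sprayDeriv_lagrangian h] at h1
  have h2 := H.sprayDeriv_eq h (lagrangian F)
  linarith

/-- The horizontal derivatives of `F` vanish. -/
theorem delta_self (H : IsFramedOn U F m e) (h : (x, y) ∈ U) (j : Fin 2) : delta F j F x y = 0 := by
  have h1 := H.dy_sprayDeriv_lagrangian h j
  rw [(isDerivationOn_dy H.isOpen j).congr (fun x y h => H.sprayDeriv_lagrangian h) h,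
    (isDerivationOn_dy H.isOpen j).const 0 h] at h1
  unfold lagrangian at h1
  rw [(isDerivationOn_delta H.isOpen F j).sq H.homogeneous.smooth h] at h1
  have h0 := H.ne_zero h
  simpa [h0] using h1.symm

end IsFramedOn

theorem h1_eq (F f : CoordFn) (x y : Plane) :
    h1 F f x y = delta F 0 f x y * ellUp F 0 x y + delta F 1 f x y * ellUp F 1 x y := by
  rw [h1, Fin.sum_univ_two]

namespace IsFramedOn

theorem h2_eq (H : IsFramedOn U F m e) (h : (x, y) ∈ U) (f : CoordFn) :
    h2 F m f x y = e * (delta F 0 f x y * up F m 0 x y + delta F 1 f x y * up F m 1 x y) := by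
  rw [h2, Fin.sum_univ_two, H.eps_eq x y h]

theorem delta_eq_frame (H : IsFramedOn U F m e) (h : (x, y) ∈ U) (f : CoordFn) (j : Fin 2) :
    delta F j f x y = h1 F f x y * dy j F x y + h2 F m f x y * m j x y := by
  have := H.covector_eq h (fun j => delta F j f x y) j
  rw [h1_eq, H.h2_eq h, this]

theorem sprayDeriv_eq_mul_h1 (H : IsFramedOn U F m e) (h : (x, y) ∈ U) (f : CoordFn) :
    sprayDeriv F f x y = F x y * h1 F f x y := by
  have h0 := H.ne_zero h
  rw [H.sprayDeriv_eq h, h1_eq, ellUp, ellUp]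
  field_simp

theorem homogeneous_h1 (H : IsFramedOn U F m e) {n : ℝ} {f : CoordFn} (hf : HomogeneousOn U n f) :
    HomogeneousOn U n (h1 F f) := by
  have h (i) := ((H.homogeneous_delta hf i).mul H.isOpen (H.homogeneous_ellUp i)).congr_deg
    (add_zero n)
  exact ((h 0).add H.isOpen (h 1)).congr H.isOpen fun x y _ => h1_eq F f x y

theorem homogeneous_h2 (H : IsFramedOn U F m e) {n : ℝ} {f : CoordFn} (hf : HomogeneousOn U n f) :
    HomogeneousOn U n (h2 F m f) := by
  have h (i) := ((H.homogeneous_delta hf i).mul H.isOpen (H.homogeneous_up i)).congr_deg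
    (add_zero n)
  exact (((h 0).add H.isOpen (h 1)).const_mul H.isOpen e).congr H.isOpen
    fun x y h => H.h2_eq h f

/-- The vertical derivative of a function of degree `0`. -/
theorem mul_dy_of_zero (H : IsFramedOn U F m e) (hφ : HomogeneousOn U 0 φ) (h : (x, y) ∈ U)
    (j : Fin 2) : F x y * dy j φ x y = v2 F m φ x y * m j x y := by
  rw [H.mul_dy hφ h]; ring

end IsFramedOn

/-- The anisotropic conformal change `e^φ F` of `F`. -/
def conformal (F φ : CoordFn) : CoordFn := fun x y => Real.exp (φ x y) * F x y

/-- The factor `τ` of `m_i m_j` in `e^{-2φ} ḡ_{ij}`; it is `1 / ρ`. -/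
def conformalFactor (F : CoordFn) (m : Fin 2 → CoordFn) (φ : CoordFn) : CoordFn := fun x y =>
  sigma F m φ x y + eps F x y - v2 F m φ x y ^ 2

namespace IsFramedOn

theorem homogeneous_conformal (H : IsFramedOn U F m e) (hφ : HomogeneousOn U 0 φ) :
    HomogeneousOn U 1 (conformal F φ) :=
  ((hφ.exp H.isOpen).mul H.isOpen H.homogeneous).congr_deg (zero_add 1)

theorem dy_conformal (H : IsFramedOn U F m e) (hφ : HomogeneousOn U 0 φ) (h : (x, y) ∈ U)
    (j : Fin 2) : dy j (conformal F φ) x y =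
      Real.exp (φ x y) * (dy j F x y + v2 F m φ x y * m j x y) := by
  have hD := isDerivationOn_dy H.isOpen j
  unfold conformal
  rw [hD.mul hφ.smooth.exp H.homogeneous.smooth h, hD.exp hφ.smooth h]
  linear_combination Real.exp (φ x y) * H.mul_dy_of_zero hφ h j

theorem conformalFactor_eq (H : IsFramedOn U F m e) (h : (x, y) ∈ U) :
    conformalFactor F m φ x y = v2 F m (v2 F m φ) x y + e * mainScalar F m x y * v2 F m φ x y
      + v2 F m φ x y ^ 2 + e := by
  rw [conformalFactor, sigma, H.eps_eq x y h]; ring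

/-- The metric tensor of `e^φ F`. -/
theorem metric_conformal (H : IsFramedOn U F m e) (hφ : HomogeneousOn U 0 φ) (h : (x, y) ∈ U)
    (i j : Fin 2) : metric (conformal F φ) x y i j = Real.exp (φ x y) ^ 2 *
      ((dy i F x y + v2 F m φ x y * m i x y) * (dy j F x y + v2 F m φ x y * m j x y)
        + conformalFactor F m φ x y * m i x y * m j x y) := by
  have hU := H.isOpen
  have hD := isDerivationOn_dy hU i
  have hl := H.homogeneous.smooth.dy hU j
  have hφ' := H.homogeneous_v2 hφ
  rw [FinslerSurface.metric_eq hU (H.homogeneous_conformal hφ).smooth h, H.dy_conformal hφ h,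
    H.dy_conformal hφ h, hD.congr (fun x y h => H.dy_conformal hφ h j) h,
    hD.mul hφ.smooth.exp (hl.add (hφ'.smooth.mul (H.smooth j))) h, hD.exp hφ.smooth h,
    hD.add hl (hφ'.smooth.mul (H.smooth j)) h, hD.mul hφ'.smooth (H.smooth j) h,
    H.conformalFactor_eq h, conformal]
  have h1 := H.mul_dy_of_zero hφ h i
  have h2 := H.mul_dy_of_zero hφ' h i
  have h3 := H.mul_dy_m h j i
  have h4 := H.mul_dy_dy h i j
  linear_combination Real.exp (φ x y) ^ 2 *
    ((dy j F x y + v2 F m φ x y * m j x y) * h1 + h4 + m j x y * h2 + v2 F m φ x y * h3)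

theorem det_metric_conformal (H : IsFramedOn U F m e) (hφ : HomogeneousOn U 0 φ)
    (h : (x, y) ∈ U) : (metric (conformal F φ) x y).det =
      Real.exp (φ x y) ^ 4 * conformalFactor F m φ x y * area F m x y ^ 2 := by
  rw [Matrix.det_fin_two]
  simp only [H.metric_conformal hφ h, area]
  ring

/-- The factor `τ` is the left-hand side of the admissibility condition. -/
theorem admissible_eq (H : IsFramedOn U F m e) (hφ : HomogeneousOn U 0 φ) (h : (x, y) ∈ U) :
    F x y ^ 2 * (∑ i, ∑ j, (dy i (dy j φ) x y + dy i φ x y * dy j φ x y) *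
      up F m i x y * up F m j x y) + eps F x y = conformalFactor F m φ x y := by
  have hφ' := H.homogeneous_v2 hφ
  have h1 (i) := H.mul_dy_of_zero hφ h i
  have h2 (i) := H.mul_dy_of_zero hφ' h i
  have key (i j : Fin 2) : F x y ^ 2 * (dy i (dy j φ) x y + dy i φ x y * dy j φ x y) =
      (v2 F m (v2 F m φ) x y + e * mainScalar F m x y * v2 F m φ x y + v2 F m φ x y ^ 2)
        * m i x y * m j x y
      - v2 F m φ x y * (dy i F x y * m j x y + dy j F x y * m i x y) := by
    have hD := isDerivationOn_dy H.isOpen i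
    have h3 := hD.mul_apply_of_mul_eq H.homogeneous.smooth (hφ.smooth.dy H.isOpen j)
      (fun x y h => H.mul_dy_of_zero hφ h j) h
    rw [hD.mul hφ'.smooth (H.smooth j) h] at h3
    linear_combination F x y * h3 + m j x y * h2 i + v2 F m φ x y * H.mul_dy_m h j i
      - dy i F x y * h1 j + F x y * dy j φ x y * h1 i + v2 F m φ x y * m i x y * h1 j
  rw [H.conformalFactor_eq h, H.eps_eq x y h]
  simp only [Fin.sum_univ_two]
  have c1 := H.ell_up h
  have c2 := H.m_up h
  have e2 := H.sq_eq_one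
  set T := v2 F m (v2 F m φ) x y + e * mainScalar F m x y * v2 F m φ x y + v2 F m φ x y ^ 2
  set u0 := up F m 0 x y
  set u1 := up F m 1 x y
  linear_combination u0 * u0 * key 0 0 + u0 * u1 * key 0 1 + u1 * u0 * key 1 0
    + u1 * u1 * key 1 1 + T * (m 0 x y * u0 + m 1 x y * u1 + e) * c2
    - 2 * v2 F m φ x y * (m 0 x y * u0 + m 1 x y * u1) * c1 + T * e2

/-! ### The spray and the Berwald curvature of the conformal change -/

theorem conformalFactor_ne_zero (H : IsFramedOn U F m e) (hφ : HomogeneousOn U 0 φ)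
    (hadm : Admissible F m φ U) (h : (x, y) ∈ U) : conformalFactor F m φ x y ≠ 0 := by
  rw [← H.admissible_eq hφ h]
  exact hadm x y h

theorem homogeneous_conformalFactor (H : IsFramedOn U F m e) (hφ : HomogeneousOn U 0 φ) :
    HomogeneousOn U 0 (conformalFactor F m φ) := by
  have hU := H.isOpen
  have h1 := H.homogeneous_v2 hφ
  have h2 := H.homogeneous_v2 h1
  have h3 := ((H.homogeneous_mainScalar.mul hU h1).congr_deg (zero_add 0)).const_mul hU e
  have h4 := (h1.mul hU h1).congr_deg (zero_add 0)
  exact (((h2.add hU h3).add hU h4).add hU (HomogeneousOn.const hU e)).congr hU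
    fun x y h => by rw [H.conformalFactor_eq h]; ring

theorem homogeneous_rho (H : IsFramedOn U F m e) (hφ : HomogeneousOn U 0 φ)
    (hadm : Admissible F m φ U) : HomogeneousOn U 0 (rho F m φ) :=
  (((H.homogeneous_conformalFactor hφ).inv H.isOpen
    fun _ _ h => H.conformalFactor_ne_zero hφ hadm h).congr H.isOpen
    fun _ _ _ => one_div _).congr_deg neg_zero

end IsFramedOn

/-- The expression `φ_{;2} φ_{,1} + φ_{,1;2} - 2 φ_{,2}` that `P` and `Q` share. -/
def sprayN (F : CoordFn) (m : Fin 2 → CoordFn) (φ : CoordFn) : CoordFn := fun x y =>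
  v2 F m φ x y * h1 F φ x y + v2 F m (h1 F φ) x y - 2 * h2 F m φ x y

namespace IsFramedOn

theorem homogeneous_sprayN (H : IsFramedOn U F m e) (hφ : HomogeneousOn U 0 φ) :
    HomogeneousOn U 0 (sprayN F m φ) := by
  have hU := H.isOpen
  have h1 := H.homogeneous_h1 hφ
  exact ((((H.homogeneous_v2 hφ).mul hU h1).congr_deg (zero_add 0)).add hU
    (H.homogeneous_v2 h1)).sub hU ((H.homogeneous_h2 hφ).const_mul hU 2)

theorem homogeneous_sprayQ (H : IsFramedOn U F m e) (hφ : HomogeneousOn U 0 φ)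
    (hadm : Admissible F m φ U) : HomogeneousOn U 2 (sprayQ F m φ) := by
  have hU := H.isOpen
  have h := ((H.homogeneous_rho hφ hadm).mul hU (H.homogeneous_sprayN hφ)).mul hU
    (H.homogeneous.mul hU H.homogeneous)
  exact ((h.const_mul hU (e / 2)).congr hU fun x y h => by
    rw [sprayQ, H.eps_eq x y h, sprayN]; ring).congr_deg (by norm_num)

theorem homogeneous_sprayP (H : IsFramedOn U F m e) (hφ : HomogeneousOn U 0 φ)
    (hadm : Admissible F m φ U) : HomogeneousOn U 2 (sprayP F m φ) := by
  have hU := H.isOpen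
  have hF := H.homogeneous.mul hU H.homogeneous
  have h1 := (((H.homogeneous_rho hφ hadm).mul hU (H.homogeneous_sprayN hφ)).mul hU
    (H.homogeneous_v2 hφ)).mul hU hF |>.congr_deg (show (0 : ℝ) + 0 + 0 + (1 + 1) = 2 by norm_num)
  have h2 := ((H.homogeneous_h1 hφ).mul hU hF).congr_deg (show (0 : ℝ) + (1 + 1) = 2 by norm_num)
  exact ((h1.const_mul hU (-1 / 2)).add hU (h2.const_mul hU (1 / 2))).congr hU fun x y h => by
    rw [sprayP, sprayN]; ring

theorem sprayDeriv_lagrangian_conformal (H : IsFramedOn U F m e) (hφ : HomogeneousOn U 0 φ)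
    (h : (x, y) ∈ U) : sprayDeriv F (lagrangian (conformal F φ)) x y =
      2 * (lagrangian (conformal F φ) x y * (F x y * h1 F φ x y)) := by
  have hD := isDerivationOn_sprayDeriv H.isOpen F
  have hs : sprayDeriv F F x y = 0 := by
    rw [H.sprayDeriv_eq h, H.delta_self h, H.delta_self h]; ring
  have h2 := hD.sq (H.homogeneous_conformal hφ).smooth h
  have h3 := hD.mul hφ.smooth.exp H.homogeneous.smooth h
  rw [hD.exp hφ.smooth h, hs, H.sprayDeriv_eq_mul_h1 h φ] at h3
  change sprayDeriv F (fun x y => conformal F φ x y ^ 2) x y = _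
  change sprayDeriv F (conformal F φ) x y = _ at h3
  rw [h2, h3, lagrangian, conformal]; ring

theorem delta_lagrangian_conformal (H : IsFramedOn U F m e) (hφ : HomogeneousOn U 0 φ)
    (h : (x, y) ∈ U) (j : Fin 2) : delta F j (lagrangian (conformal F φ)) x y =
      2 * (lagrangian (conformal F φ) x y * delta F j φ x y) := by
  have hD := isDerivationOn_delta H.isOpen F j
  have h2 := hD.sq (H.homogeneous_conformal hφ).smooth h
  have h3 := hD.mul hφ.smooth.exp H.homogeneous.smooth h
  rw [hD.exp hφ.smooth h, H.delta_self h] at h3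
  change delta F j (fun x y => conformal F φ x y ^ 2) x y = _
  change delta F j (conformal F φ) x y = _ at h3
  rw [h2, h3, lagrangian, conformal]; ring

/-- The Euler–Lagrange expression of `e^{2φ} F²`, up to the part that comes from the spray
of `F`. -/
theorem dy_sprayDeriv_sub_delta_conformal (H : IsFramedOn U F m e) (hφ : HomogeneousOn U 0 φ)
    (h : (x, y) ∈ U) (j : Fin 2) :
    dy j (sprayDeriv F (lagrangian (conformal F φ))) x y
        - 2 * delta F j (lagrangian (conformal F φ)) x y =
      2 * Real.exp (φ x y) ^ 2 * F x y ^ 2 *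
        (h1 F φ x y * dy j F x y + (2 * v2 F m φ x y * h1 F φ x y + v2 F m (h1 F φ) x y
          - 2 * h2 F m φ x y) * m j x y) := by
  have hU := H.isOpen
  have hD := isDerivationOn_dy hU j
  have hc := H.homogeneous_conformal hφ
  have ha := H.homogeneous_h1 hφ
  have hF := H.homogeneous.smooth
  have hL := (hc.lagrangian hU).smooth
  rw [hD.congr (fun x y h => H.sprayDeriv_lagrangian_conformal hφ h) h,
    hD.const_mul 2 (hL.mul (hF.mul ha.smooth)) h, hD.mul hL (hF.mul ha.smooth) h,
    hD.mul hF ha.smooth h, dy_lagrangian hU hc.smooth h, H.dy_conformal hφ h,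
    H.delta_lagrangian_conformal hφ h, H.delta_eq_frame h, lagrangian, conformal]
  have h1 := H.mul_dy ha h j
  linear_combination 2 * Real.exp (φ x y) ^ 2 * F x y ^ 2 * h1

/-- The geodesic spray of `e^φ F`. -/
theorem spray_conformal (H : IsFramedOn U F m e) (hφ : HomogeneousOn U 0 φ)
    (hadm : Admissible F m φ U) (h : (x, y) ∈ U) (i : Fin 2) :
    spray (conformal F φ) i x y =
      spray F i x y + frameVector F m (sprayP F m φ) (sprayQ F m φ) i x y := by
  have hc := H.homogeneous_conformal hφ
  have hτ := H.conformalFactor_ne_zero hφ hadm h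
  have hdet : (metric (conformal F φ) x y).det ≠ 0 := by
    rw [H.det_metric_conformal hφ h]
    exact mul_ne_zero (mul_ne_zero (pow_ne_zero _ (Real.exp_ne_zero _)) hτ)
      (pow_ne_zero _ (H.area_ne_zero h))
  refine eq_spray hdet (v := fun i => spray F i x y
    + frameVector F m (sprayP F m φ) (sprayQ F m φ) i x y) (fun j => ?_) i
  rw [H.eulerLagrange_eq h (hc.lagrangian H.isOpen).smooth j,
    H.dy_sprayDeriv_sub_delta_conformal hφ h, dy_dy_lagrangian, dy_dy_lagrangian]
  have e2 := H.sq_eq_one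
  -- Both sides are compared along `ℓ_j` and along `m_j`.
  have hP : sprayP F m φ x y + e * v2 F m φ x y * sprayQ F m φ x y =
      F x y ^ 2 * h1 F φ x y / 2 := by
    rw [sprayP, sprayQ, H.eps_eq x y h, ← sprayN]
    linear_combination (v2 F m φ x y * rho F m φ x y * F x y ^ 2 * sprayN F m φ x y / 2) * e2
  have hQ : e * conformalFactor F m φ x y * sprayQ F m φ x y =
      F x y ^ 2 * sprayN F m φ x y / 2 := by
    have hr : rho F m φ x y * conformalFactor F m φ x y = 1 := one_div_mul_cancel hτ
    rw [sprayQ, H.eps_eq x y h, ← sprayN]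
    linear_combination (e * e * F x y ^ 2 * sprayN F m φ x y / 2) * hr
      + (F x y ^ 2 * sprayN F m φ x y / 2) * e2
  have c1 := H.ell_up h
  have c2 := H.m_up h
  have c3 := H.ell_ellUp h
  have c4 := H.m_ellUp h
  rw [sprayN] at hQ
  simp only [H.metric_conformal hφ h, frameVector]
  set P := sprayP F m φ x y
  set Q := sprayQ F m φ x y
  set E := Real.exp (φ x y)
  set τ := conformalFactor F m φ x y
  set s := v2 F m φ x y
  linear_combination (4 * E ^ 2 * (dy j F x y + s * m j x y)) * (hP + P * c3 + s * P * c4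
      + Q * c1 + s * Q * c2)
    + 4 * E ^ 2 * m j x y * (hQ + τ * P * c4 + τ * Q * c2)

/-- The Berwald curvature of `e^φ F` in terms of the third vertical derivatives of the difference
of the geodesic sprays. -/
theorem berwaldCurvature_conformal (H : IsFramedOn U F m e) (hφ : HomogeneousOn U 0 φ)
    (hadm : Admissible F m φ U) (h : (x, y) ∈ U) (i j k r : Fin 2) :
    berwaldCurvature (conformal F φ) i j k r x y = berwaldCurvature F i j k r x y
      + dy r (dy j (dy k (frameVector F m (sprayP F m φ) (sprayQ F m φ) i))) x y := by
  have hU := H.isOpen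
  have hG := (H.homogeneous_spray i).smooth
  have hV := (H.homogeneous_frameVector (H.homogeneous_sprayP hφ hadm)
    (H.homogeneous_sprayQ hφ hadm) i).smooth
  have s1 (x y) (h : (x, y) ∈ U) := ((isDerivationOn_dy hU k).congr
    (fun x y h => H.spray_conformal hφ hadm h i) h).trans
    ((isDerivationOn_dy hU k).add hG hV h)
  have s2 (x y) (h : (x, y) ∈ U) := ((isDerivationOn_dy hU j).congr s1 h).trans
    ((isDerivationOn_dy hU j).add (hG.dy hU k) (hV.dy hU k) h)
  exact ((isDerivationOn_dy hU r).congr s2 h).trans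
    ((isDerivationOn_dy hU r).add ((hG.dy hU k).dy hU j) ((hV.dy hU k).dy hU j) h)

end IsFramedOn

/-- Near each point the signature is constant. -/
theorem exists_isFramedOn {U : Set (Plane × Plane)} {F : CoordFn} {m : Fin 2 → CoordFn}
    {x y : Plane} (hU : IsOpen U) (hF : HomogeneousOn U 1 F)
    (hdet : ∀ x y, (x, y) ∈ U → (metric F x y).det ≠ 0) (hm : IsBerwaldFrame F U m)
    (h : (x, y) ∈ U) :
    ∃ V ⊆ U, (x, y) ∈ V ∧ IsFramedOn V F m (eps F x y) := by
  have hg := fun i j => (hF.metric hU i j).smooth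
  have hc : ContinuousOn (fun p : Plane × Plane => (metric F p.1 p.2).det) U := by
    have := (((hg 0 0).mul (hg 1 1)).sub ((hg 0 1).mul (hg 1 0))).congr
      (g := fun x y => (metric F x y).det) fun x y _ => Matrix.det_fin_two _
    exact ContDiffOn.continuousOn this
  have main (S : Set ℝ) (hS : IsOpen S) (hxy : (metric F x y).det ∈ S)
      (he : ∀ t ∈ S, Real.sign t = eps F x y) (h2 : eps F x y * eps F x y = 1) :
      ∃ V ⊆ U, (x, y) ∈ V ∧ IsFramedOn V F m (eps F x y) := by
    refine ⟨U ∩ (fun p : Plane × Plane => (metric F p.1 p.2).det) ⁻¹' S,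
      Set.inter_subset_left, ⟨h, hxy⟩, ?_⟩
    have hε (x' y') (h' : (x', y') ∈ U ∩ (fun p : Plane × Plane => (metric F p.1 p.2).det) ⁻¹' S) :
      eps F x' y' = eps F x y := he _ h'.2
    exact {
      isOpen := hc.isOpen_inter_preimage hU hS
      homogeneous :=
        ⟨ContDiffOn.mono hF.smooth Set.inter_subset_left, fun x y h => hF.euler x y h.1⟩
      det_ne_zero := fun x y h => hdet x y h.1
      eps_eq := hε
      sq_eq_one := h2
      smooth := fun i => ContDiffOn.mono (hm.smooth i) Set.inter_subset_left
      angular_eq := fun x' y' h' i j => by rw [hm.angular_eq x' y' h'.1, hε x' y' h'] }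
  rcases lt_or_gt_of_ne (hdet x y h) with hlt | hgt
  · have : eps F x y = -1 := Real.sign_of_neg hlt
    exact main (Set.Iio 0) isOpen_Iio hlt (fun t ht => by rw [this, Real.sign_of_neg ht])
      (by rw [this]; norm_num)
  · have : eps F x y = 1 := Real.sign_of_pos hgt
    exact main (Set.Ioi 0) isOpen_Ioi hgt (fun t ht => by rw [this, Real.sign_of_pos ht])
      (by rw [this]; norm_num)

end FinslerSurface

end

open FinslerSurface
theorem mainTheorem4 {M : Type*} [TopologicalSpace M] [ChartedSpace Plane M]
    [IsManifold (𝓡 2) ∞ M]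
    (A : Set (TangentBundle (𝓡 2) M)) (F φ : TangentBundle (𝓡 2) M → ℝ)
    (hF : IsConicPseudoFinsler A F)
    (hφ_smooth : ContMDiffOn (𝓡 2).tangent 𝓘(ℝ, ℝ) ∞ φ A)
    (hφ_homogeneous : IsHomogeneous A 0 φ)
    (e : OpenPartialHomeomorph M Plane) (he : e ∈ IsManifold.maximalAtlas (𝓡 2) ∞ M)
    (m : Fin 2 → CoordFn) (hm : IsBerwaldFrame (inChart e F) (coordDomain e A) m)
    (hadm : Admissible (inChart e F) m (inChart e φ) (coordDomain e A))
    (x y : Plane) (hxy : (x, y) ∈ coordDomain e A) (i j k r : Fin 2) :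
    let f : CoordFn := inChart e F
    let fbar : CoordFn := inChart e (fun u => Real.exp (φ u) * F u)
    let ε : ℝ := eps f x y
    let I : CoordFn := mainScalar f m
    let p : CoordFn := sprayP f m (inChart e φ)
    let q : CoordFn := sprayQ f m (inChart e φ)
    let D : CoordFn → CoordFn := v2 f m
    f x y ^ 3 * berwaldCurvature fbar i j k r x y =
      f x y ^ 3 * berwaldCurvature f i j k r x y +
      (((-3 + D I x y) * ε * q x y
          + (1 + D I x y + 2 * ε * I x y ^ 2) * ε * D p x y
          + D (D (D p)) x y - 3 * D (D q) x y
          + 3 * ε * I x y * D (D p) x y - 3 * ε * I x y * D q x y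
          + 2 * I x y * p x y) * ellUp f i x y
        + (3 * p x y
          - (I x y + ε * D (D I) x y + I x y * D I x y) * q x y
          - (2 * ε * D I x y + I x y ^ 2 - ε) * D q x y
          + 3 * ε * D (D p) x y + D (D (D q)) x y
          + 3 * I x y * D p x y) * up f m i x y)
      * m j x y * m k x y * m r x y := by
  have hU := isOpen_coordDomain he hF.conic.isOpen
  have hf : HomogeneousOn (coordDomain e A) 1 (inChart e F) :=
    ⟨smoothOn_inChart he hF.smooth, fun x y h => by
      simpa using euler_inChart he hF.conic.isOpen hF.smooth hF.homogeneous h⟩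
  have hφ : HomogeneousOn (coordDomain e A) 0 (inChart e φ) :=
    ⟨smoothOn_inChart he hφ_smooth, fun x y h => by
      simpa using euler_inChart he hF.conic.isOpen hφ_smooth hφ_homogeneous h⟩
  obtain ⟨V, hVU, hV, H⟩ := exists_isFramedOn hU hf (hF.nondegenerate e he) hm hxy
  have hφV : HomogeneousOn V 0 (inChart e φ) :=
    ⟨ContDiffOn.mono hφ.smooth hVU, fun x y h => hφ.euler x y (hVU h)⟩
  have hadmV : Admissible (inChart e F) m (inChart e φ) V := fun x y h => hadm x y (hVU h)
  intro f fbar ε I p q D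
  have h1 : berwaldCurvature fbar i j k r x y = _ :=
    H.berwaldCurvature_conformal hφV hadmV hV i j k r
  have h2 := H.cube_mul_dy_dy_dy_frameVector (H.homogeneous_sprayP hφV hadmV)
    (H.homogeneous_sprayQ hφV hadmV) hV i j k r
  rw [h1, mul_add, h2]
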